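/- Work in the pure group language $\{+\}$. A family of subsets of a set is \emph{directed} if any two of its members are nested or disjoint. A first-order theory $T$ is \emph{VC-minimal} if there is a set $\Psi$ of parameter-free formulas $\psi(x;\bar y)$ ($x$ a single variable, the length of $\bar y$ depending on $\psi$) such that in every model $M$ of $T$ the family of sets $\psi(M;\bar a)=\{b\in M : M\models\psi(b;\bar a)\}$, for $\psi\in\Psi$ and $\bar a$ a tuple from $M$, is directed, and every subset of $M$ definable with parameters is a boolean combination of members of this family. For an abelian group $A$ and a cardinal $\kappa$, $A^{(\kappa)}$ denotes the direct sum of $\kappa$ copies of $A$. For a prime $p$, $\mathbb{Z}(p^\infty)$ is the Pr\"ufer $p$-group $\varinjlim_k \mathbb{Z}/p^k\mathbb{Z}$ and $\mathbb{Z}_{(p)}$ is the additive group of the localization of $\mathbb{Z}$ at the prime ideal $(p)$. Let $A$ be one of the following abelian groups: \begin{enumerate} \item $(\mathbb{Z};+)$; \item $(\mathbb{Z}/p^k\mathbb{Z})^{(\aleph_0)}$, for any prime $p$ and any integer $k\ge 0$; \item $(\mathbb{Z}/p^k\mathbb{Z})^{(\aleph_0)}\oplus(\mathbb{Z}/p^{k+1}\mathbb{Z})^{(\aleph_0)}$,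 for any prime $p$ and any integer $k\ge 0$; \item $\mathbb{Z}(p^\infty)^{(\beta)}\oplus\mathbb{Z}_{(p)}^{(\gamma)}$, for any prime $p$ and any cardinals $\beta,\gamma$ (finite or infinite). \end{enumerate} Then the theory $\mathrm{Th}(A;+)$ is VC-minimal. Moreover, there is a set $\mathcal H$ of p.p.-definable subgroups of $A$ (that is, finite intersections of subgroups of the form $\{x\in A : \exists y\in A,\ ky=mx\}$ with $k,m\ge 0$ integers) that is linearly ordered by inclusion and such that the subsets of $A$ definable with parameters in $(A;+)$ are exactly the boolean combinations of cosets of members of $\mathcal H$. -/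

import Mathlib

universe u v w

/-! ### Directed families and VC-minimal theories -/

namespace VCMinimality

/-- A family of subsets of `X` is directed if any two members are nested or disjoint. -/
def IsDirectedFamily {X : Type*} (B : Set (Set X)) : Prop :=
  ∀ S ∈ B, ∀ R ∈ B, S ⊆ R ∨ R ⊆ S ∨ S ∩ R = ∅

/-- A partitioned formula `ψ(x; y₁, …, yₙ)`: the object variable `x` is `Sum.inl ()`, the parameter
variables are `Sum.inr i`. The length `n` depends on the formula. -/
structure PartitionedFormula (L : FirstOrder.Language.{u, v}) where
  arity : ℕ
  formula : L.Formula (Unit ⊕ Fin arity)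

/-- The set `ψ(M; a) = {b ∈ M : M ⊨ ψ(b; a)}`. -/
def definedSet {L : FirstOrder.Language.{u, v}} {M : Type w} [L.Structure M]
    (ψ : PartitionedFormula L) (a : Fin ψ.arity → M) : Set M :=
  {b | ψ.formula.Realize (Sum.elim (fun _ => b) a)}

/-- The sets defined in `M` by the instances of the formulas of `Ψ`. -/
def instancesIn {L : FirstOrder.Language.{u, v}} (Ψ : Set (PartitionedFormula L)) (M : Type w)
    [L.Structure M] : Set (Set M) :=
  {S | ∃ ψ ∈ Ψ, ∃ a : Fin ψ.arity → M, S = definedSet ψ a}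

/-- `Ψ` is directed for `T`: in every model of `T` the instances of `Ψ` form a directed family. -/
def IsDirected {L : FirstOrder.Language.{u, v}} (T : L.Theory)
    (Ψ : Set (PartitionedFormula L)) : Prop :=
  ∀ M : FirstOrder.Language.Theory.ModelType.{u, v, w} T, IsDirectedFamily (instancesIn Ψ M)

/-- In every model of `T`, every subset of the model that is definable by a formula in one variable
with arbitrary parameters from the model is a (finite) boolean combination of instances of `Ψ`. -/
def Generates {L : FirstOrder.Language.{u, v}} (T : L.Theory)
    (Ψ : Set (PartitionedFormula L)) : Prop :=
  ∀ (M : FirstOrder.Language.Theory.ModelType.{u, v, w} T) (S : Set M),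
    (Set.univ : Set M).Definable₁ L S → S ∈ BooleanSubalgebra.closure (instancesIn Ψ M)

/-- `T` is VC-minimal if it has a directed generating family (of parameter-free partitioned
formulas). The models range over the universe `w`. -/
def IsVCMinimal {L : FirstOrder.Language.{u, v}} (T : L.Theory) : Prop :=
  ∃ Ψ : Set (PartitionedFormula L), IsDirected.{u, v, w} T Ψ ∧ Generates.{u, v, w} T Ψ

/-! ### The pure group language -/

/-- The function symbols of the pure group language: only a binary `+`. -/
inductive AddFunctions : ℕ → Type
  | add : AddFunctions 2

/-- The pure group language `{+}`. -/
def addLanguage : FirstOrder.Language.{0, 0} where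
  Functions := AddFunctions
  Relations := fun _ => Empty

instance addStructure (A : Type*) [Add A] : addLanguage.Structure A where
  funMap := fun {_} f =>
    match f with
    | .add => fun x => x 0 + x 1
  RelMap := fun r => nomatch r

/-! ### Chains of p.p.-definable subgroups -/

/-- The subgroup `φ_{k,m}(A) = {x ∈ A : ∃ y, k • y = m • x}`. -/
def phiSubgroup (A : Type*) [AddCommGroup A] (k m : ℕ) : AddSubgroup A where
  carrier := {x | ∃ y : A, k • y = m • x}
  zero_mem' := ⟨0, by simp⟩
  add_mem' := by
    rintro x x' ⟨y, hy⟩ ⟨y', hy'⟩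
    exact ⟨y + y', by rw [smul_add, smul_add, hy, hy']⟩
  neg_mem' := by
    rintro x ⟨y, hy⟩
    exact ⟨-y, by rw [smul_neg, smul_neg, hy]⟩

/-- `PP(A)`: the p.p.-definable subgroups of `A`, namely the finite intersections of subgroups of
the form `φ_{k,m}(A)`. -/
def PP (A : Type*) [AddCommGroup A] : Set (AddSubgroup A) :=
  {H | ∃ s : Finset (ℕ × ℕ), H = ⨅ q ∈ s, phiSubgroup A q.1 q.2}

/-- The cosets in `A` of the members of a set `𝓗` of subgroups. -/
def cosetsOf {A : Type*} [AddCommGroup A] (𝓗 : Set (AddSubgroup A)) : Set (Set A) :=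
  {S | ∃ H ∈ 𝓗, ∃ a : A, S = {x | x - a ∈ H}}

/-- There is a chain of p.p.-definable subgroups of `A` whose cosets generate, by boolean
combinations, exactly the parameter-definable subsets of `A`. -/
def HasGeneratingPPChain (A : Type*) [AddCommGroup A] : Prop :=
  ∃ 𝓗 ⊆ PP A, IsChain (· ≤ ·) 𝓗 ∧
    ∀ S : Set A, (Set.univ : Set A).Definable₁ addLanguage S ↔
      S ∈ BooleanSubalgebra.closure (cosetsOf 𝓗)

/-! ### The groups -/

/-- Multiplication by `p ^ (j - i)` as a map `ℤ/p^i → ℤ/p^j`, the standard embedding. -/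
def pruferMap (p i j : ℕ) (h : i ≤ j) : ZMod (p ^ i) →+ ZMod (p ^ j) :=
  ZMod.lift (p ^ i) ⟨zmultiplesHom (ZMod (p ^ j)) ((p : ZMod (p ^ j)) ^ (j - i)), by
    simp only [zmultiplesHom_apply, zsmul_eq_mul]
    push_cast
    rw [← pow_add, Nat.add_sub_cancel' h, ← Nat.cast_pow, ZMod.natCast_self]⟩

/-- The Prüfer group `ℤ(p^∞)`: the direct limit of the groups `ℤ/p^k`. -/
abbrev Prufer (p : ℕ) : Type :=
  AddCommGroup.DirectLimit (fun k : ℕ => ZMod (p ^ k)) (pruferMap p)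

instance isPrime_span_natCast (p : ℕ) [hp : Fact p.Prime] :
    (Ideal.span {(p : ℤ)}).IsPrime :=
  (Ideal.span_singleton_prime (by exact_mod_cast hp.out.ne_zero)).2
    (Nat.prime_iff_prime_int.1 hp.out)

/-- `ℤ_(p)`: the localization of `ℤ` at the prime ideal `(p)`. -/
abbrev ZLocalized (p : ℕ) [Fact p.Prime] : Type :=
  Localization.AtPrime (Ideal.span {(p : ℤ)})

end VCMinimality

/-! The proof rests on Baur–Monk quantifier elimination: in an abelian group, every
parameter-definable subset of the line is a boolean combination of cosets of the groups `phiSubgroup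
M k m` (`mem_closure_of_definable₁`). The induction on formulas is nontrivial only at a quantifier,
where a projection must preserve boolean combinations of p.p. cosets (`image_mem_closure_cosetsOf`).
This holds because B. H. Neumann's lemma and inclusion–exclusion decide whether finitely many cosets
cover a group from which subfamilies meet (`cover_of_common_point_iff`). Smith normal form then
reduces one-variable p.p. conditions to the groups `phiSubgroup M k m`.

It remains to find a chain of such subgroups with a member of finite index inside every `phiSubgroup
A k m`. Cosets of a chain are directed, and a coset of the larger group is a finite union of cosets
of the smaller. Inclusions and covers by a fixed number of cosets are first-order, so they pass from
`A` to every model (`isVCMinimal_and_hasGeneratingPPChain`).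

For the groups attached to a prime, only the subgroups p^i A and A[p^j] occur, and they form a chain
because either A[p^j] ⊆ p^i A or p^(i+j) A = 0. In ℤ the subgroups nℤ are not a chain, but 0 and the
n!ℤ are, and they suffice up to finite index. -/

namespace VCMinimality

open FirstOrder FirstOrder.Language

/-! ### Boolean combinations and membership patterns. -/

section Boolean

variable {X : Type*}

/-- Membership in a boolean combination depends only on membership in finitely many generators. -/
theorem mem_closure_iff_finite_pattern {C : Set (Set X)} {S : Set X} :
    S ∈ BooleanSubalgebra.closure C ↔
      ∃ F : Finset (Set X), (F : Set (Set X)) ⊆ C ∧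
        ∀ x y, (∀ D ∈ F, x ∈ D ↔ y ∈ D) → x ∈ S → y ∈ S := by
  classical
  constructor
  · intro h
    induction h using BooleanSubalgebra.closure_bot_sup_induction with
    | mem S hS => exact ⟨{S}, by simpa using hS, fun x y h => (h S (by simp)).1⟩
    | bot => exact ⟨∅, by simp, fun x y _ h => h.elim⟩
    | sup S _ R _ ihS ihR =>
      obtain ⟨F, hF, hFS⟩ := ihS
      obtain ⟨G, hG, hGR⟩ := ihR
      refine ⟨F ∪ G, by simp [hF, hG], fun x y h hx => ?_⟩
      rcases hx with hx | hx
      · exact Or.inl (hFS x y (fun D hD => h D (Finset.mem_union_left _ hD)) hx)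
      · exact Or.inr (hGR x y (fun D hD => h D (Finset.mem_union_right _ hD)) hx)
    | compl S _ ih =>
      obtain ⟨F, hF, hFS⟩ := ih
      exact ⟨F, hF, fun x y h hx hy => hx (hFS y x (fun D hD => (h D hD).symm) hy)⟩
  · rintro ⟨F, hF, hFS⟩
    let pat : X → Set F := fun x => {D | x ∈ D.1}
    -- `S` is the union of the atoms of the patterns it realises, finitely many because `F` is
    -- finite.
    have hS : S = ⨆ τ ∈ pat '' S, ⨅ D : F, if D ∈ τ then D.1 else D.1ᶜ := by
      ext y
      simp only [Set.iSup_eq_iUnion, Set.iInf_eq_iInter, Set.mem_iUnion, Set.mem_iInter]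
      constructor
      · intro hy
        refine ⟨pat y, ⟨y, hy, rfl⟩, fun D => ?_⟩
        split_ifs with h
        · exact h
        · exact h
      · rintro ⟨_, ⟨x, hx, rfl⟩, h⟩
        refine hFS x y (fun D hD => ?_) hx
        have := h ⟨D, hD⟩
        split_ifs at this with h'
        · exact ⟨fun _ => this, fun _ => h'⟩
        · exact ⟨fun h'' => (h' h'').elim, fun h'' => (this h'').elim⟩
    rw [hS]
    refine BooleanSubalgebra.biSup_mem (Set.toFinite _) fun τ _ =>
      BooleanSubalgebra.iInf_mem fun D => ?_
    split_ifs
    · exact BooleanSubalgebra.subset_closure (hF D.2)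
    · exact BooleanSubalgebra.compl_mem (BooleanSubalgebra.subset_closure (hF D.2))

end Boolean

/-! ### Coset covers and projections. -/

section Cosets

open scoped Pointwise in
/-- Whether a finite family of cosets covers an abelian group depends only on which of its
subfamilies have a common point. -/
theorem cover_of_common_point_iff {H ι : Type*} [AddCommGroup H] [Finite ι] (K : ι → AddSubgroup H)
    (S R : ι → Set H) (hS : ∀ i, ∀ x ∈ S i, ∀ y, y ∈ S i ↔ y - x ∈ K i)
    (hR : ∀ i, ∀ x ∈ R i, ∀ y, y ∈ R i ↔ y - x ∈ K i)
    (h : ∀ T : Finset ι, (∃ x, ∀ i ∈ T, x ∈ S i) ↔ ∃ x, ∀ i ∈ T, x ∈ R i)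
    (hc : ∀ x, ∃ i, x ∈ S i) (x : H) : ∃ i, x ∈ R i := by
  classical
  have := Fintype.ofFinite ι
  let s : Finset ι := Finset.univ.filter fun i => (S i).Nonempty
  let g : ι → H := fun i => if h : (S i).Nonempty then h.some else 0
  have hg : ∀ i ∈ s, g i ∈ S i := by
    intro i hi
    have hi' : (S i).Nonempty := by simpa [s] using hi
    simp only [g, hi', dif_pos]
    exact hi'.some_mem
  have hcov : ⋃ i ∈ s, g i +ᵥ (K i : Set H) = Set.univ := by
    refine Set.eq_univ_of_forall fun y => ?_
    obtain ⟨i, hi⟩ := hc y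
    have his : i ∈ s := by simpa [s] using ⟨y, hi⟩
    refine Set.mem_biUnion his ?_
    rw [mem_leftAddCoset_iff]
    have := (hS i _ (hg i his) y).1 hi
    rwa [neg_add_eq_sub]
  -- Neumann's lemma: cosets of infinite-index subgroups can be dropped from a finite cover.
  have hfin := AddSubgroup.leftCoset_cover_filter_FiniteIndex hcov
  let J := s.filter fun i => (K i).FiniteIndex
  have hcJ : ∀ y, ∃ i ∈ J, y ∈ S i := by
    intro y
    have hy : y ∈ (Set.univ : Set H) := trivial
    rw [← hfin] at hy
    obtain ⟨i, hi, hy⟩ := Set.mem_iUnion₂.1 hy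
    refine ⟨i, hi, (hS i _ (hg i (Finset.mem_filter.1 hi).1) y).2 ?_⟩
    rw [mem_leftAddCoset_iff] at hy
    rwa [neg_add_eq_sub] at hy
  -- The remaining sets are unions of cosets of `N`, so they can be counted in the finite quotient.
  let N : AddSubgroup H := ⨅ i : J, K i
  have hN : N.FiniteIndex :=
    AddSubgroup.finiteIndex_iInf fun i => (Finset.mem_filter.1 i.2).2
  have hNK : ∀ i ∈ J, N ≤ K i := fun i hi => iInf_le (fun i : J => K i) ⟨i, hi⟩
  have : Finite (H ⧸ N) := AddSubgroup.finite_quotient_of_finiteIndex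
  have := Fintype.ofFinite (H ⧸ N)
  let q : H → H ⧸ N := QuotientAddGroup.mk
  have hout : ∀ y, (q y).out - y ∈ N := by
    intro y
    have : q (q y).out = q y := Quotient.out_eq' (q y)
    have := (QuotientAddGroup.eq (s := N)).1 this.symm
    rwa [neg_add_eq_sub] at this
  have inv : ∀ Q : ι → Set H, (∀ i, ∀ x ∈ Q i, ∀ y, y ∈ Q i ↔ y - x ∈ K i) → ∀ i ∈ J, ∀ y z,
      z - y ∈ N → y ∈ Q i → z ∈ Q i := fun Q hQ i hi y z hyz hy =>
    (hQ i y hy z).2 (hNK i hi hyz)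
  have inv' : ∀ Q : ι → Set H, (∀ i, ∀ x ∈ Q i, ∀ y, y ∈ Q i ↔ y - x ∈ K i) → ∀ i ∈ J, ∀ y,
      (q y).out ∈ Q i ↔ y ∈ Q i := fun Q hQ i hi y =>
    ⟨inv Q hQ i hi _ _ (by simpa using neg_mem (hout y)), inv Q hQ i hi _ _ (hout y)⟩
  let tr : (ι → Set H) → ι → Finset (H ⧸ N) := fun Q i => Finset.univ.filter fun c => c.out ∈ Q i
  -- Nonempty intersections over `T` on both sides are cosets of the same subgroup, so translating
  -- by the difference of two points compares them; otherwise both are empty.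
  have hcard : ∀ T ∈ J.powerset, (T.inf (tr S)).card = (T.inf (tr R)).card := by
    intro T hT
    have hTJ : ∀ i ∈ T, i ∈ J := fun i hi => Finset.mem_powerset.1 hT hi
    have hmem : ∀ Q : ι → Set H, ∀ c, c ∈ T.inf (tr Q) ↔ ∀ i ∈ T, c.out ∈ Q i := by
      intro Q c
      rw [Finset.mem_inf]
      simp [tr]
    by_cases hne : ∃ x, ∀ i ∈ T, x ∈ S i
    · obtain ⟨a, ha⟩ := hne
      obtain ⟨b, hb⟩ := (h T).1 ⟨a, ha⟩
      have shift : ∀ Q Q' : ι → Set H, (∀ i, ∀ x ∈ Q i, ∀ y, y ∈ Q i ↔ y - x ∈ K i) →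
          (∀ i, ∀ x ∈ Q' i, ∀ y, y ∈ Q' i ↔ y - x ∈ K i) → ∀ a b, (∀ i ∈ T, a ∈ Q i) →
          (∀ i ∈ T, b ∈ Q' i) → (T.inf (tr Q)).card ≤ (T.inf (tr Q')).card := by
        intro Q Q' hQ hQ' a b ha hb
        refine Finset.card_le_card_of_injOn (fun c => c + q (b - a)) ?_
          (fun c _ d _ hcd => by simpa using hcd)
        intro c hc
        have hc := (hmem Q c).1 hc
        refine (hmem Q' _).2 fun i hi => ?_
        have hcq : c + q (b - a) = q (c.out + (b - a)) := by
          have : q c.out = c := Quotient.out_eq' c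
          exact congrArg (· + q (b - a)) this.symm
        change (c + q (b - a)).out ∈ Q' i
        rw [hcq, inv' Q' hQ' i (hTJ i hi), hQ' i b (hb i hi)]
        have := (hQ i a (ha i hi) _).1 (hc i hi)
        convert this using 1
        abel
      exact le_antisymm (shift S R hS hR a b ha hb) (shift R S hR hS b a hb ha)
    · have hne' : ¬ ∃ x, ∀ i ∈ T, x ∈ R i := fun h' => hne ((h T).2 h')
      have e1 : T.inf (tr S) = ∅ := Finset.eq_empty_of_forall_notMem fun c hc =>
        hne ⟨_, (hmem S c).1 hc⟩
      have e2 : T.inf (tr R) = ∅ := Finset.eq_empty_of_forall_notMem fun c hc =>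
        hne' ⟨_, (hmem R c).1 hc⟩
      rw [e1, e2]
  have hIE : ((J.inf fun i => (tr S i)ᶜ).card : ℤ) = (J.inf fun i => (tr R i)ᶜ).card := by
    rw [Finset.inclusion_exclusion_card_inf_compl, Finset.inclusion_exclusion_card_inf_compl]
    exact Finset.sum_congr rfl fun T hT => by rw [hcard T hT]
  have h0 : (J.inf fun i => (tr S i)ᶜ) = ∅ := by
    refine Finset.eq_empty_of_forall_notMem fun c hc => ?_
    obtain ⟨i, hi, hy⟩ := hcJ c.out
    have := (Finset.mem_inf.1 hc) i hi
    simp [tr, hy] at this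
  rw [h0] at hIE
  have h1 : (J.inf fun i => (tr R i)ᶜ) = ∅ := by
    rw [← Finset.card_eq_zero]
    exact_mod_cast hIE.symm
  have hx : q x ∉ J.inf fun i => (tr R i)ᶜ := by simp [h1]
  rw [Finset.mem_inf] at hx
  push Not at hx
  obtain ⟨i, hi, hx⟩ := hx
  refine ⟨i, (inv' R hR i hi x).1 ?_⟩
  simpa [tr] using hx

/-- Whether a fibre of a homomorphism contains a point lying on prescribed members of a finite
family of cosets depends only on which subfamilies have a common point in the fibre. -/
theorem exists_pattern_of_common_point_iff {E Y ι : Type*} [AddCommGroup E] [AddCommGroup Y]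
    [Finite ι] (f : E →+ Y) (G : ι → AddSubgroup E) (C : ι → Set E)
    (hC : ∀ i, ∀ x ∈ C i, ∀ y, y ∈ C i ↔ y - x ∈ G i) (τ : Set ι) (y z : Y)
    (h : ∀ T : Set ι, (∃ e, f e = y ∧ ∀ i ∈ T, e ∈ C i) ↔ ∃ e, f e = z ∧ ∀ i ∈ T, e ∈ C i)
    (hy : ∃ e, f e = y ∧ ∀ i, e ∈ C i ↔ i ∈ τ) : ∃ e, f e = z ∧ ∀ i, e ∈ C i ↔ i ∈ τ := by
  by_contra hz
  obtain ⟨a, ha, haC⟩ := hy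
  obtain ⟨b, hb, hbC⟩ := (h τ).1 ⟨a, ha, fun i hi => (haC i).2 hi⟩
  -- The points over `y` and over `z` lying on all `C i` with `i ∈ τ` form the cosets `a + H` and `b
  -- + H`. The pattern `τ` is missed over `z` exactly when the other `C i` cover `b + H`; they would
  -- then cover `a + H`, which the point `a` refutes.
  let H : AddSubgroup E := f.ker ⊓ ⨅ i ∈ τ, G i
  have memH : ∀ e, e ∈ H ↔ f e = 0 ∧ ∀ i ∈ τ, e ∈ G i := by
    intro e
    simp [H, AddSubgroup.mem_inf, AddSubgroup.mem_iInf, AddMonoidHom.mem_ker]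
  have coset : ∀ (c : E), (∀ i : {i // i ∉ τ}, ∀ x ∈ {x : H | c + x.1 ∈ C i}, ∀ y : H,
      y ∈ {x : H | c + x.1 ∈ C i} ↔ y - x ∈ (G i).addSubgroupOf H) := by
    intro c i x hx y
    simp only [Set.mem_ofPred_eq] at hx ⊢
    rw [hC i _ hx, AddSubgroup.mem_addSubgroupOf]
    simp
  have pts : ∀ c w, f c = w → (∀ i ∈ τ, c ∈ C i) → ∀ T : Finset {i // i ∉ τ},
      (∃ x : H, ∀ i ∈ T, c + x.1 ∈ C i) ↔
        ∃ e, f e = w ∧ ∀ i ∈ τ ∪ {i | ∃ h : i ∉ τ, ⟨i, h⟩ ∈ T}, e ∈ C i := by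
    intro c w hcw hc T
    constructor
    · rintro ⟨x, hx⟩
      refine ⟨c + x, by rw [map_add, ((memH _).1 x.2).1, hcw, add_zero], ?_⟩
      rintro i (hi | ⟨hi, hiT⟩)
      · rw [hC i c (hc i hi)]
        simpa using ((memH _).1 x.2).2 i hi
      · exact hx _ hiT
    · rintro ⟨e, hew, he⟩
      refine ⟨⟨e - c, (memH _).2 ⟨by rw [map_sub, hew, hcw, sub_self], fun i hi => ?_⟩⟩, ?_⟩
      · exact (hC i c (hc i hi) e).1 (he i (Or.inl hi))
      · intro i hi
        simpa using he i (Or.inr ⟨i.2, hi⟩)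
  have key := cover_of_common_point_iff (fun i : {i // i ∉ τ} => (G i).addSubgroupOf H)
    (fun i => {x : H | b + x.1 ∈ C i}) (fun i => {x : H | a + x.1 ∈ C i}) (coset b) (coset a)
    (fun T => ((pts b z hb hbC T).trans (h _).symm).trans
      (pts a y ha (fun i hi => (haC i).2 hi) T).symm)
  obtain ⟨i, hi⟩ := key (by
    intro x
    by_contra hx
    push Not at hx
    refine hz ⟨b + x, by rw [map_add, ((memH _).1 x.2).1, hb, add_zero], fun i => ?_⟩
    constructor
    · intro hi
      by_contra hiτ
      exact hx ⟨i, hiτ⟩ hi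
    · intro hi
      rw [hC i b (hbC i hi)]
      simpa using ((memH _).1 x.2).2 i hi) 0
  exact i.2 ((haC i).1 (by simpa using hi))

/-- Images under a homomorphism of boolean combinations of cosets of subgroups from a family closed
under finite intersections are boolean combinations of cosets of the images of these subgroups. -/
theorem image_mem_closure_cosetsOf {E Y : Type*} [AddCommGroup E] [AddCommGroup Y] (f : E →+ Y)
    {P : Set (AddSubgroup E)} {Q : Set (AddSubgroup Y)} (htop : ⊤ ∈ P)
    (hinf : ∀ G ∈ P, ∀ G' ∈ P, G ⊓ G' ∈ P) (hmap : ∀ G ∈ P, G.map f ∈ Q) {S : Set E}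
    (hS : S ∈ BooleanSubalgebra.closure (cosetsOf P)) :
    f '' S ∈ BooleanSubalgebra.closure (cosetsOf Q) := by
  classical
  obtain ⟨F, hF, hFS⟩ := mem_closure_iff_finite_pattern.1 hS
  have hF' : ∀ D ∈ F, ∃ G ∈ P, ∃ a : E, D = {x | x - a ∈ G} := fun D hD => hF hD
  choose! G hG c hc using hF'
  have hmem : ∀ D : F, ∀ x ∈ D.1, ∀ y, y ∈ D.1 ↔ y - x ∈ G D.1 := by
    intro D x hx y
    have hD : ∀ z, z ∈ D.1 ↔ z - c D.1 ∈ G D.1 := fun z => by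
      conv_lhs => rw [hc D.1 D.2]
      rfl
    rw [hD] at hx ⊢
    rw [← sub_sub_sub_cancel_right y x (c D.1)]
    exact ⟨fun h => sub_mem h hx, fun h => by simpa using add_mem h hx⟩
  have hP : ∀ T : Finset F, (⨅ D ∈ T, G D.1) ∈ P := by
    intro T
    induction T using Finset.induction_on with
    | empty => simpa using htop
    | insert D T _ ih =>
      rw [Finset.iInf_insert]
      exact hinf _ (hG D.1 D.2) _ ih
  -- These images of intersections are the finitely many sets that decide membership in the image of
  -- `S`; an empty one need not be a coset and is filtered out.
  let I : Finset F → Set Y := fun T => f '' {e | ∀ D ∈ T, e ∈ D.1}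
  have hI : ∀ T, (I T).Nonempty → I T ∈ cosetsOf Q := by
    rintro T ⟨_, e, he, rfl⟩
    refine ⟨_, hmap _ (hP T), f e, ?_⟩
    ext y
    simp only [Set.mem_ofPred_eq, AddSubgroup.mem_map, AddSubgroup.mem_iInf, I, Set.mem_image]
    constructor
    · rintro ⟨d, hd, rfl⟩
      exact ⟨d - e, fun D hD => (hmem D e (he D hD) d).1 (hd D hD), map_sub _ _ _⟩
    · rintro ⟨d, hd, hde⟩
      refine ⟨e + d, fun D hD => (hmem D e (he D hD) _).2 (by simpa using hd D hD), ?_⟩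
      rw [map_add, hde]
      abel
  refine mem_closure_iff_finite_pattern.2
    ⟨(Finset.univ.image I).filter (fun A => A.Nonempty), ?_, ?_⟩
  · intro A hA
    simp only [Finset.coe_filter, Set.mem_ofPred_eq, Finset.mem_image, Finset.mem_univ,
      true_and] at hA
    obtain ⟨⟨T, rfl⟩, hT⟩ := hA
    exact hI T hT
  · rintro y z hyz ⟨e, he, rfl⟩
    obtain ⟨d, hd, hdD⟩ := exists_pattern_of_common_point_iff f (fun D : F => G D.1)
      (fun D => D.1) hmem {D | e ∈ D.1} (f e) z (by
        intro T
        have hT : ∀ w, (∃ d, f d = w ∧ ∀ D ∈ T, d ∈ D.1) ↔ w ∈ I T.toFinset := by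
          intro w
          simp only [I, Set.mem_toFinset, Set.mem_image, Set.mem_ofPred_eq]
          exact exists_congr fun _ => and_comm
        rw [hT, hT]
        by_cases hne : (I T.toFinset).Nonempty
        · exact hyz _ (Finset.mem_filter.2 ⟨Finset.mem_image_of_mem _ (Finset.mem_univ _), hne⟩)
        · rw [Set.not_nonempty_iff_eq_empty] at hne
          simp [hne]) ⟨e, rfl, fun D => Iff.rfl⟩
    exact ⟨d, hFS e d (fun D hD => (hdD ⟨D, hD⟩).symm) he, hd⟩

end Cosets

/-! ### Integer linear systems and p.p. subgroups. -/

section PositivePrimitive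

variable {M ι κ : Type*} [AddCommGroup M] [Fintype ι] [Fintype κ]

/-- The value `∑ i, r i • x i` of an integer linear form. -/
def intForm (r : ι → ℤ) (x : ι → M) : M := ∑ i, r i • x i

theorem intForm_add (r : ι → ℤ) (x y : ι → M) :
    intForm r (x + y) = intForm r x + intForm r y := by
  simp [intForm, Finset.sum_add_distrib]

theorem intForm_zero (r : ι → ℤ) : intForm r (0 : ι → M) = 0 := by simp [intForm]

theorem intForm_neg (r : ι → ℤ) (x : ι → M) : intForm r (-x) = -intForm r x := by
  simp [intForm]

theorem intForm_sub (r : ι → ℤ) (x y : ι → M) :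
    intForm r (x - y) = intForm r x - intForm r y := by
  rw [sub_eq_add_neg, intForm_add, intForm_neg, sub_eq_add_neg]

theorem add_intForm (r s : ι → ℤ) (x : ι → M) :
    intForm (r + s) x = intForm r x + intForm s x := by
  simp [intForm, add_smul, Finset.sum_add_distrib]

theorem sub_intForm (r s : ι → ℤ) (x : ι → M) :
    intForm (r - s) x = intForm r x - intForm s x := by
  simp [intForm, sub_smul]

theorem zero_intForm (x : ι → M) : intForm (0 : ι → ℤ) x = 0 := by simp [intForm]

theorem neg_intForm (r : ι → ℤ) (x : ι → M) : intForm (-r) x = -intForm r x := by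
  simp [intForm]

theorem single_intForm [DecidableEq ι] (i : ι) (x : ι → M) :
    intForm (Pi.single i 1) x = x i := by
  simp [intForm, Pi.single_apply]

theorem intForm_sum_elim (r : ι → ℤ) (s : κ → ℤ) (x : ι ⊕ κ → M) :
    intForm (Sum.elim r s) x = intForm r (x ∘ Sum.inl) + intForm s (x ∘ Sum.inr) := by
  simp [intForm]

/-- The subgroups of `ι → M` defined by positive primitive formulas: the projections of solution
sets of systems of homogeneous integer linear equations. -/
def ppSubgroups (M ι : Type*) [AddCommGroup M] [Fintype ι] : Set (AddSubgroup (ι → M)) :=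
  {G | ∃ (n : ℕ) (R : Set ((ι → ℤ) × (Fin n → ℤ))),
    ∀ x, x ∈ G ↔ ∃ z, ∀ r ∈ R, intForm r.1 x + intForm r.2 z = 0}

theorem mem_ppSubgroups_of_fintype {G : AddSubgroup (ι → M)} (R : Set ((ι → ℤ) × (κ → ℤ)))
    (h : ∀ x, x ∈ G ↔ ∃ z, ∀ r ∈ R, intForm r.1 x + intForm r.2 z = 0) :
    G ∈ ppSubgroups M ι := by
  let e := Fintype.equivFin κ
  have he : ∀ (r : κ → ℤ) (z : Fin (Fintype.card κ) → M),
      intForm (r ∘ e.symm) z = intForm r (z ∘ e) := fun r z => by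
    simp only [intForm, Function.comp]
    exact (Equiv.sum_comp e.symm fun k => r k • z (e k)).symm ▸ by simp
  refine ⟨Fintype.card κ, (fun r => (r.1, r.2 ∘ e.symm)) '' R, fun x => ?_⟩
  rw [h]
  constructor
  · rintro ⟨z, hz⟩
    refine ⟨z ∘ e.symm, ?_⟩
    rintro _ ⟨r, hr, rfl⟩
    have := hz r hr
    simpa [he, Function.comp_assoc] using this
  · rintro ⟨z, hz⟩
    refine ⟨z ∘ e, fun r hr => ?_⟩
    rw [← he]
    exact hz _ ⟨r, hr, rfl⟩

theorem top_mem_ppSubgroups : (⊤ : AddSubgroup (ι → M)) ∈ ppSubgroups M ι :=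
  ⟨0, ∅, fun x => by simp⟩

theorem inf_mem_ppSubgroups {G H : AddSubgroup (ι → M)} (hG : G ∈ ppSubgroups M ι)
    (hH : H ∈ ppSubgroups M ι) : G ⊓ H ∈ ppSubgroups M ι := by
  obtain ⟨m, R, hR⟩ := hG
  obtain ⟨n, S, hS⟩ := hH
  refine mem_ppSubgroups_of_fintype (κ := Fin m ⊕ Fin n)
    ((fun r => (r.1, Sum.elim r.2 0)) '' R ∪ (fun r => (r.1, Sum.elim 0 r.2)) '' S) fun x => ?_
  rw [AddSubgroup.mem_inf, hR, hS]
  constructor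
  · rintro ⟨⟨y, hy⟩, ⟨z, hz⟩⟩
    refine ⟨Sum.elim y z, ?_⟩
    rintro _ (⟨r, hr, rfl⟩ | ⟨r, hr, rfl⟩)
    · simpa [intForm_sum_elim, zero_intForm] using hy r hr
    · simpa [intForm_sum_elim, zero_intForm] using hz r hr
  · rintro ⟨z, hz⟩
    refine ⟨⟨z ∘ Sum.inl, fun r hr => ?_⟩, ⟨z ∘ Sum.inr, fun r hr => ?_⟩⟩
    · simpa [intForm_sum_elim, zero_intForm] using hz _ (Or.inl ⟨r, hr, rfl⟩)
    · simpa [intForm_sum_elim, zero_intForm] using hz _ (Or.inr ⟨r, hr, rfl⟩)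

/-- Existential quantification: the whole preimage vector joins the witnesses, tied to `x` by the
equations `x i = y (f i)`. -/
theorem map_funLeft_mem_ppSubgroups (f : ι → κ) {G : AddSubgroup (κ → M)}
    (hG : G ∈ ppSubgroups M κ) :
    G.map (LinearMap.funLeft ℤ M f).toAddMonoidHom ∈ ppSubgroups M ι := by
  classical
  obtain ⟨n, R, hR⟩ := hG
  refine mem_ppSubgroups_of_fintype (κ := κ ⊕ Fin n)
    ((fun r => (0, Sum.elim r.1 r.2)) '' R ∪
      Set.range fun i => (Pi.single i 1, Sum.elim (-Pi.single (f i) 1) 0)) fun x => ?_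
  rw [AddSubgroup.mem_map]
  constructor
  · rintro ⟨y, hy, rfl⟩
    obtain ⟨z, hz⟩ := (hR y).1 hy
    refine ⟨Sum.elim y z, ?_⟩
    rintro _ (⟨r, hr, rfl⟩ | ⟨i, rfl⟩)
    · simpa [intForm_sum_elim, zero_intForm] using hz r hr
    · simp [intForm_sum_elim, zero_intForm, neg_intForm, single_intForm, LinearMap.funLeft_apply]
  · rintro ⟨z, hz⟩
    refine ⟨z ∘ Sum.inl, (hR _).2 ⟨z ∘ Sum.inr, fun r hr => ?_⟩, ?_⟩
    · simpa [intForm_sum_elim, zero_intForm] using hz _ (Or.inl ⟨r, hr, rfl⟩)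
    · ext i
      have := hz _ (Or.inr ⟨i, rfl⟩)
      simp only [intForm_sum_elim, zero_intForm, neg_intForm, single_intForm, add_zero,
        Function.comp] at this
      exact (add_neg_eq_zero.1 this).symm

/-- The kernel of an integer linear form is defined by a positive primitive formula. -/
theorem exists_ker_mem_ppSubgroups (r : ι → ℤ) :
    ∃ G ∈ ppSubgroups M ι, ∀ x, x ∈ G ↔ intForm r x = 0 :=
  ⟨{ carrier := {x | intForm r x = 0}
     zero_mem' := intForm_zero r
     add_mem' := fun {x y} hx hy => by
      change intForm r (x + y) = 0
      rw [intForm_add, hx, hy, add_zero]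
     neg_mem' := fun {x} hx => by
      change intForm r (-x) = 0
      rw [intForm_neg, hx, neg_zero] },
    ⟨0, {(r, 0)}, fun x => by
      have h0 : ∀ (s : Fin 0 → ℤ) (z : Fin 0 → M), intForm s z = 0 := fun s z => by simp [intForm]
      simp only [Set.mem_singleton_iff, forall_eq, h0, add_zero, exists_const]
      rfl⟩, fun _ => Iff.rfl⟩

theorem mem_phiSubgroup_natAbs (a c : ℤ) (x : M) :
    x ∈ phiSubgroup M a.natAbs c.natAbs ↔ ∃ y : M, a • y = c • x := by
  change (∃ y : M, a.natAbs • y = c.natAbs • x) ↔ _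
  have h : ∀ (n : ℤ) (y : M), n.natAbs • y = n • y ∨ n.natAbs • y = -(n • y) := by
    intro n y
    rw [← natCast_zsmul]
    rcases Int.natAbs_eq n with h | h
    · exact Or.inl (by rw [← h])
    · right
      conv_rhs => rw [h]
      simp
  constructor
  · rintro ⟨y, hy⟩
    rcases h a y with h1 | h1 <;> rcases h c x with h2 | h2 <;> rw [h1, h2] at hy
    · exact ⟨y, hy⟩
    · exact ⟨-y, by rw [smul_neg, hy, neg_neg]⟩
    · exact ⟨-y, by rw [smul_neg, hy]⟩
    · exact ⟨y, neg_injective hy⟩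
  · rintro ⟨y, hy⟩
    rcases h a y with h1 | h1 <;> rcases h c x with h2 | h2
    · exact ⟨y, by rw [h1, h2, hy]⟩
    · exact ⟨-y, by rw [smul_neg, h1, h2, hy]⟩
    · exact ⟨-y, by rw [smul_neg, h1, h2, hy, neg_neg]⟩
    · exact ⟨y, by rw [h1, h2, hy]⟩

/-- In one variable, a positive primitive formula amounts to a finite conjunction of divisibility
conditions `∃ y, k • y = m • x`. This follows from the Smith normal form over `ℤ`. -/
theorem exists_finset_phiSubgroup (M : Type*) [AddCommGroup M] (R : Set (ℤ × (κ → ℤ))) :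
    ∃ s : Finset (ℕ × ℕ), ∀ x : M,
      (∃ z : κ → M, ∀ r ∈ R, r.1 • x + intForm r.2 z = 0) ↔
        ∀ q ∈ s, x ∈ phiSubgroup M q.1 q.2 := by
  classical
  -- `P` consists of all linear consequences of the system. A Smith basis of its projection to the
  -- `z`-coefficients decouples the unknowns, even for infinite `R`.
  let P : Submodule ℤ (ℤ × (κ → ℤ)) := Submodule.span ℤ R
  let N : Submodule ℤ (κ → ℤ) := P.map (LinearMap.snd ℤ ℤ (κ → ℤ))
  obtain ⟨n, B, BN, f, a, hsnf⟩ := Submodule.smithNormalForm (Pi.basisFun ℤ κ) N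
  have hlift : ∀ i, ∃ c : ℤ, (c, a i • B (f i)) ∈ P := by
    intro i
    have := (BN i).2
    rw [hsnf] at this
    obtain ⟨⟨c, t⟩, hct, ht⟩ := Submodule.mem_map.1 this
    have ht : t = a i • B (f i) := ht
    exact ⟨c, ht ▸ hct⟩
  choose c hc using hlift
  obtain ⟨d, hd⟩ : ∃ d : ℤ, P.comap (LinearMap.inl ℤ ℤ (κ → ℤ)) = Ideal.span {d} :=
    ⟨_, (Ideal.span_singleton_generator _).symm⟩
  have hd' : ∀ e : ℤ, (e, (0 : κ → ℤ)) ∈ P ↔ d ∣ e := by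
    intro e
    rw [← Ideal.mem_span_singleton, ← hd]
    rfl
  -- The generator `d` of the consequences free of `z` gives `d • x = 0`; each Smith basis vector
  -- gives one divisibility condition of `c i • x` by `a i`.
  refine ⟨insert (0, d.natAbs) (Finset.univ.image fun i => ((a i).natAbs, (c i).natAbs)),
    fun x => ?_⟩
  have hform : ∀ L : (κ → ℤ) →ₗ[ℤ] M, ∀ r, intForm r (fun k => L (Pi.single k 1)) = L r := by
    intro L r
    conv_rhs => rw [pi_eq_sum_univ' r]
    simp only [intForm, map_sum, map_smul]
  constructor
  · rintro ⟨z, hz⟩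
    let L : (κ → ℤ) →ₗ[ℤ] M := Fintype.linearCombination ℤ z
    let Λ : ℤ × (κ → ℤ) →ₗ[ℤ] M := (LinearMap.toSpanSingleton ℤ M x).coprod L
    have hP : ∀ r ∈ P, r.1 • x + L r.2 = 0 := by
      intro r hr
      have : P ≤ LinearMap.ker Λ := Submodule.span_le.2 fun r hr => by
        have := hz r hr
        simpa [Λ, L, intForm, Fintype.linearCombination_apply] using this
      simpa [Λ] using this hr
    intro q hq
    rcases Finset.mem_insert.1 hq with rfl | hq
    · have := hP _ ((hd' d).2 dvd_rfl)
      rw [map_zero, add_zero] at this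
      exact (mem_phiSubgroup_natAbs 0 d x).2 ⟨0, by simpa using this.symm⟩
    · obtain ⟨i, _, rfl⟩ := Finset.mem_image.1 hq
      have := hP _ (hc i)
      rw [map_smul] at this
      refine (mem_phiSubgroup_natAbs (a i) (c i) x).2 ⟨-L (B (f i)), ?_⟩
      rw [smul_neg]
      exact (eq_neg_of_add_eq_zero_left this).symm
  · intro hx
    have hdx : d • x = 0 := by
      obtain ⟨y, hy⟩ := (mem_phiSubgroup_natAbs 0 d x).1 (hx _ (Finset.mem_insert_self _ _))
      rw [← hy, zero_smul]
    have hw : ∀ i, ∃ y, a i • y = c i • x := fun i =>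
      (mem_phiSubgroup_natAbs (a i) (c i) x).1 (hx _ (Finset.mem_insert_of_mem
        (Finset.mem_image_of_mem _ (Finset.mem_univ _))))
    choose w hw using hw
    -- The solution `z` is read off a homomorphism prescribed on the Smith basis: minus the
    -- witnesses on the vectors `B (f i)`, zero on the others.
    let L : (κ → ℤ) →ₗ[ℤ] M := B.constr ℤ (Function.extend f (-w) 0)
    have hL : ∀ i, L (B (f i)) = -w i := fun i => by
      simp [L, f.injective.extend_apply]
    let Λ : ℤ × (κ → ℤ) →ₗ[ℤ] M := (LinearMap.toSpanSingleton ℤ M x).coprod L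
    have hΛ : ∀ r, Λ r = r.1 • x + L r.2 := fun r => by simp [Λ]
    refine ⟨fun k => L (Pi.single k 1), fun r hr => ?_⟩
    rw [hform, ← hΛ]
    have hrP : r ∈ P := Submodule.subset_span hr
    let t : N := ⟨r.2, Submodule.mem_map_of_mem (f := LinearMap.snd ℤ ℤ (κ → ℤ)) hrP⟩
    -- `ρ` has the same `z`-part as `r`, so `r - ρ` involves `x` alone and is a multiple of `d`.
    let ρ : ℤ × (κ → ℤ) := ∑ i, BN.repr t i • (c i, a i • B (f i))
    have hρ : ρ ∈ P := Submodule.sum_mem _ fun i _ => Submodule.smul_mem _ _ (hc i)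
    have hρ2 : ρ.2 = r.2 := by
      have : ((∑ i, BN.repr t i • BN i : N) : κ → ℤ) = r.2 := by rw [BN.sum_repr]
      rw [← this]
      simp only [ρ, Prod.snd_sum, Prod.smul_snd, AddSubmonoidClass.coe_finsetSum, SetLike.val_smul,
        hsnf]
    have hΛρ : Λ ρ = 0 := by
      simp only [ρ, map_sum, map_smul]
      refine Finset.sum_eq_zero fun i _ => ?_
      rw [hΛ, map_smul, hL, smul_neg, hw, add_neg_cancel, smul_zero]
    have hsub : r - ρ ∈ P := sub_mem hrP hρ
    have : r - ρ = ((r - ρ).1, 0) := Prod.ext rfl (by simp [hρ2])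
    rw [this, hd'] at hsub
    obtain ⟨e, he⟩ := hsub
    have : Λ (r - ρ) = 0 := by
      rw [this, hΛ, map_zero, add_zero, he, mul_comm, mul_smul, hdx, smul_zero]
    rwa [map_sub, hΛρ, sub_zero] at this

end PositivePrimitive

/-! ### Quantifier elimination. -/

section Definable

variable {M : Type*} [AddCommGroup M] [addLanguage.Structure M]

/-- The structure is tied to the group only through `hadd`, because in a model of the theory the
group is reconstructed from the structure. Parameters contribute the constant `d`. -/
theorem exists_intForm_eq_realize
    (hadd : ∀ v : Fin 2 → M, Structure.funMap (L := addLanguage) AddFunctions.add v = v 0 + v 1)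
    {γ : Type*} [Fintype γ] (t : addLanguage[[(Set.univ : Set M)]].Term γ) :
    ∃ (r : γ → ℤ) (d : M), ∀ v : γ → M, t.realize v = intForm r v + d := by
  classical
  induction t with
  | var i => exact ⟨Pi.single i 1, 0, fun v => by simp [single_intForm]⟩
  | @func l f ts ih =>
    choose r d h using ih
    rcases f with f | f
    · cases f
      refine ⟨r 0 + r 1, d 0 + d 1, fun v => ?_⟩
      refine (hadd fun i => (ts i).realize v).trans ?_
      rw [h, h, add_intForm]
      abel
    · cases l with
      | zero =>
        refine ⟨0, Structure.funMap (L := addLanguage[[(Set.univ : Set M)]]) (Sum.inr f) default,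
          fun v => ?_⟩
        rw [zero_intForm, zero_add]
        exact congrArg (Structure.funMap (L := addLanguage[[(Set.univ : Set M)]]) (Sum.inr f))
          (Subsingleton.elim (fun i => (ts i).realize v) default)
      | succ l => exact f.elim

theorem setOf_realize_mem_closure
    (hadd : ∀ v : Fin 2 → M, Structure.funMap (L := addLanguage) AddFunctions.add v = v 0 + v 1)
    {α : Type*} [Fintype α] {n : ℕ}
    (φ : addLanguage[[(Set.univ : Set M)]].BoundedFormula α n) :
    {w : α ⊕ Fin n → M | φ.Realize (w ∘ Sum.inl) (w ∘ Sum.inr)} ∈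
      BooleanSubalgebra.closure (cosetsOf (ppSubgroups M (α ⊕ Fin n))) := by
  induction φ with
  | falsum => exact BooleanSubalgebra.bot_mem
  | @equal n s t =>
    obtain ⟨r, d, hr⟩ := exists_intForm_eq_realize hadd s
    obtain ⟨r', d', hr'⟩ := exists_intForm_eq_realize hadd t
    obtain ⟨G, hG, hG'⟩ := exists_ker_mem_ppSubgroups (M := M) (r - r')
    have hset : {w : α ⊕ Fin n → M | (BoundedFormula.equal s t).Realize (w ∘ Sum.inl)
        (w ∘ Sum.inr)} = {w | intForm (r - r') w = d' - d} := by
      ext w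
      simp only [Set.mem_ofPred_eq, BoundedFormula.Realize, hr, hr', sub_intForm]
      rw [Sum.elim_comp_inl_inr, sub_eq_sub_iff_add_eq_add, add_comm d']
    rw [hset]
    by_cases hne : ∃ w, intForm (r - r') w = d' - d
    · obtain ⟨w, hw⟩ := hne
      refine BooleanSubalgebra.subset_closure ⟨G, hG, w, ?_⟩
      ext v
      simp only [Set.mem_ofPred_eq, hG', intForm_sub _ v, hw, sub_eq_zero]
    · have : {w : α ⊕ Fin n → M | intForm (r - r') w = d' - d} = ∅ :=
        Set.eq_empty_of_forall_notMem fun w hw => hne ⟨w, hw⟩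
      rw [this]
      exact BooleanSubalgebra.bot_mem
  | rel R ts => rcases R with R | R <;> exact R.elim
  | @imp n φ ψ ihφ ihψ =>
    have : {w : α ⊕ Fin n → M | (φ.imp ψ).Realize (w ∘ Sum.inl) (w ∘ Sum.inr)} =
        {w | φ.Realize (w ∘ Sum.inl) (w ∘ Sum.inr)}ᶜ ⊔
          {w | ψ.Realize (w ∘ Sum.inl) (w ∘ Sum.inr)} := by
      ext w
      simp [imp_iff_not_or]
    rw [this]
    exact BooleanSubalgebra.sup_mem (BooleanSubalgebra.compl_mem ihφ) ihψ
  | @all n φ ih =>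
    -- Restriction along `f` forgets the last bound variable, so ∀ is the complement of an image of
    -- a complement.
    let f : α ⊕ Fin n → α ⊕ Fin (n + 1) := Sum.map id Fin.castSucc
    have : {w : α ⊕ Fin n → M | φ.all.Realize (w ∘ Sum.inl) (w ∘ Sum.inr)} =
        ((LinearMap.funLeft ℤ M f).toAddMonoidHom ''
          {w | φ.Realize (w ∘ Sum.inl) (w ∘ Sum.inr)}ᶜ)ᶜ := by
      ext w
      simp only [Set.mem_ofPred_eq, BoundedFormula.realize_all, Set.mem_compl_iff, Set.mem_image,
        not_exists, not_and]
      constructor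
      · rintro h v hv rfl
        refine hv ?_
        have hsnoc : v ∘ Sum.inr =
            Fin.snoc (fun i : Fin n => v (Sum.inr i.castSucc)) (v (Sum.inr (Fin.last n))) := by
          funext i
          refine Fin.lastCases ?_ (fun i => ?_) i <;> simp
        change φ.Realize (v ∘ Sum.inl) (v ∘ Sum.inr)
        rw [hsnoc]
        exact h (v (Sum.inr (Fin.last n)))
      · intro h a
        by_contra ha
        refine h (Sum.elim (w ∘ Sum.inl) (Fin.snoc (w ∘ Sum.inr) a)) (by simpa using ha) ?_
        funext i
        rcases i with i | i <;> simp [LinearMap.funLeft_apply, f]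
    rw [this]
    exact BooleanSubalgebra.compl_mem (image_mem_closure_cosetsOf _ top_mem_ppSubgroups
      (fun _ hG _ hG' => inf_mem_ppSubgroups hG hG')
      (fun _ hG => map_funLeft_mem_ppSubgroups f hG) (BooleanSubalgebra.compl_mem ih))

theorem preimage_mem_closure {X Y : Type*} (g : X → Y) {C : Set (Set Y)} {D : Set (Set X)}
    (h : ∀ S ∈ C, g ⁻¹' S ∈ BooleanSubalgebra.closure D) {S : Set Y}
    (hS : S ∈ BooleanSubalgebra.closure C) : g ⁻¹' S ∈ BooleanSubalgebra.closure D := by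
  induction hS using BooleanSubalgebra.closure_bot_sup_induction with
  | mem S hS => exact h S hS
  | bot => exact BooleanSubalgebra.bot_mem
  | sup S _ R _ ihS ihR => exact BooleanSubalgebra.sup_mem ihS ihR
  | compl S _ ih => exact BooleanSubalgebra.compl_mem ih

/-- In an abelian group, every subset definable with parameters is a boolean combination of cosets
of subgroups `{x | ∃ y, k • y = m • x}`. -/
theorem mem_closure_of_definable₁
    (hadd : ∀ v : Fin 2 → M, Structure.funMap (L := addLanguage) AddFunctions.add v = v 0 + v 1)
    {S : Set M} (hS : (Set.univ : Set M).Definable₁ addLanguage S) :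
    S ∈ BooleanSubalgebra.closure
      (cosetsOf (Set.range fun q : ℕ × ℕ => phiSubgroup M q.1 q.2)) := by
  obtain ⟨φ, hφ⟩ := hS
  have hφ' := setOf_realize_mem_closure hadd φ
  let g : M → Fin 1 ⊕ Fin 0 → M := fun x _ => x
  have hpre : S = g ⁻¹' {w | BoundedFormula.Realize φ (w ∘ Sum.inl) (w ∘ Sum.inr)} := by
    ext x
    have : (fun _ : Fin 1 => x) ∈ {y : Fin 1 → M | y 0 ∈ S} ↔ Formula.Realize φ fun _ => x := by
      rw [hφ]; rfl
    refine Iff.trans this ?_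
    simp only [Set.mem_preimage, Set.mem_ofPred_eq, Formula.Realize]
    rw [Subsingleton.elim (g x ∘ Sum.inr) default]
    rfl
  rw [hpre]
  refine preimage_mem_closure g ?_ hφ'
  rintro _ ⟨G, ⟨n, R, hR⟩, a, rfl⟩
  by_cases hne : ∃ x, g x - a ∈ G
  · obtain ⟨x, hx⟩ := hne
    obtain ⟨s, hs⟩ := exists_finset_phiSubgroup M
      ((fun r : (Fin 1 ⊕ Fin 0 → ℤ) × (Fin n → ℤ) => (r.1 (Sum.inl 0), r.2)) '' R)
    have hG : ∀ y, g y ∈ G ↔ ∀ q ∈ s, y ∈ phiSubgroup M q.1 q.2 := by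
      intro y
      rw [← hs, hR]
      simp only [Set.forall_mem_image]
      simp [intForm, g]
    have : g ⁻¹' {w | w - a ∈ G} = ⨅ q ∈ (s : Set (ℕ × ℕ)),
        {y | y - x ∈ phiSubgroup M q.1 q.2} := by
      ext y
      simp only [Set.iInf_eq_iInter, Set.mem_iInter, Set.mem_ofPred_eq, Set.mem_preimage,
        Finset.mem_coe]
      rw [← hG]
      have : g (y - x) = (g y - a) - (g x - a) := by
        funext i
        simp [g]
      rw [this]
      exact ⟨fun h => sub_mem h hx, fun h => by simpa using add_mem h hx⟩
    rw [this]
    exact BooleanSubalgebra.biInf_mem s.finite_toSet fun q _ =>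
      BooleanSubalgebra.subset_closure ⟨_, ⟨q, rfl⟩, x, rfl⟩
  · have : g ⁻¹' {w | w - a ∈ G} = ∅ := Set.eq_empty_of_forall_notMem fun x hx => hne ⟨x, hx⟩
    rw [this]
    exact BooleanSubalgebra.bot_mem

end Definable

/-! ### The subgroups as formulas in the language with + only. -/

section Formulas

/-- The sum of two terms. -/
def addTerm {γ : Type*} (s t : addLanguage.Term γ) : addLanguage.Term γ :=
  Term.func (L := addLanguage) (l := 2) AddFunctions.add ![s, t]

/-- The multiple `(n + 1) • t` of a term. -/
def succSmulTerm {γ : Type*} : ℕ → addLanguage.Term γ → addLanguage.Term γ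
  | 0, t => t
  | n + 1, t => addTerm (succSmulTerm n t) t

/-- The formula `∃ y, k • y = m • (x₁ - x₀)`, written without subtraction and zero multiples. -/
def phiDiffFormula (k m : ℕ) : addLanguage.Formula (Fin 2) :=
  BoundedFormula.ex (n := 0) <| BoundedFormula.equal
    (addTerm (addTerm (succSmulTerm k (Term.var (Sum.inr 0)))
      (succSmulTerm m (Term.var (Sum.inl 0)))) (Term.var (Sum.inl 1)))
    (addTerm (addTerm (succSmulTerm m (Term.var (Sum.inl 1))) (Term.var (Sum.inr 0)))
      (Term.var (Sum.inl 0)))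

/-- The formula `∃ y, k • y = m • (s - t)`. -/
def phiFormula {γ : Type*} (k m : ℕ) (s t : addLanguage.Term γ) : addLanguage.Formula γ :=
  BoundedFormula.subst (phiDiffFormula k m) ![t, s]

variable {M : Type*} [addLanguage.Structure M]

/-- The operation interpreting the symbol `+`. -/
def structureAdd (x y : M) : M := Structure.funMap (L := addLanguage) AddFunctions.add ![x, y]

theorem funMap_add (v : Fin 2 → M) :
    Structure.funMap (L := addLanguage) AddFunctions.add v = structureAdd (v 0) (v 1) := by
  rw [structureAdd]
  congr 1
  funext i
  fin_cases i <;> rfl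

theorem realize_addTerm {γ : Type*} (s t : addLanguage.Term γ) (v : γ → M) :
    (addTerm s t).realize v = structureAdd (s.realize v) (t.realize v) :=
  funMap_add _

variable [AddCommGroup M]

theorem realize_succSmulTerm (hadd : ∀ x y : M, structureAdd x y = x + y) {γ : Type*} (n : ℕ)
    (t : addLanguage.Term γ) (v : γ → M) :
    (succSmulTerm n t).realize v = (n + 1) • t.realize v := by
  induction n with
  | zero => simp [succSmulTerm]
  | succ n ih => rw [succSmulTerm, realize_addTerm, hadd, ih, succ_nsmul _ (n + 1)]

theorem realize_phiFormula (hadd : ∀ x y : M, structureAdd x y = x + y) {γ : Type*} (k m : ℕ)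
    (s t : addLanguage.Term γ) (v : γ → M) :
    (phiFormula k m s t).Realize v ↔ s.realize v - t.realize v ∈ phiSubgroup M k m := by
  rw [phiFormula, Formula.Realize, BoundedFormula.realize_subst, phiDiffFormula,
    BoundedFormula.realize_ex]
  refine exists_congr fun y => ?_
  simp only [BoundedFormula.Realize, realize_addTerm, hadd, realize_succSmulTerm hadd,
    Term.realize_var, Sum.elim_inl, Sum.elim_inr]
  have hy : (Fin.snoc default y : Fin 1 → M) 0 = y := rfl
  simp only [hy, Matrix.cons_val_zero, Matrix.cons_val_one]
  rw [smul_sub, eq_sub_iff_add_eq, add_smul, add_smul, add_smul, one_smul, one_smul, one_smul]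
  -- Adding `y + t + s` to both sides of `k • y + m • t = m • s` makes all multiples positive and
  -- removes subtraction.
  rw [← add_left_inj (y + t.realize v + s.realize v) (b := k • y + m • t.realize v)]
  have h1 : k • y + m • t.realize v + (y + t.realize v + s.realize v) =
      k • y + y + (m • t.realize v + t.realize v) + s.realize v := by abel
  have h2 : m • s.realize v + (y + t.realize v + s.realize v) =
      m • s.realize v + s.realize v + y + t.realize v := by abel
  rw [h1, h2]

end Formulas

/-! ### Transfer of ∃∀ sentences to models. -/

section Transfer

/-- The sentence `∃ a, ∀ b, ψ(a, b)`. -/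
noncomputable def existsForallSentence {α β : Type} [Finite α] [Finite β]
    (ψ : addLanguage.Formula (α ⊕ β)) : addLanguage.Sentence :=
  Formula.iExs α ((Formula.iAlls β ψ).relabel Sum.inr)

theorem realize_existsForallSentence {N : Type*} [addLanguage.Structure N] {α β : Type} [Finite α]
    [Finite β] (ψ : addLanguage.Formula (α ⊕ β)) :
    N ⊨ existsForallSentence ψ ↔ ∃ a : α → N, ∀ b : β → N, ψ.Realize (Sum.elim a b) := by
  simp only [existsForallSentence, Sentence.Realize, Formula.realize_iExs,
    Formula.realize_relabel, Formula.realize_iAlls, Sum.elim_comp_inr]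

variable {A : Type*} [addLanguage.Structure A] {M : Type*} [addLanguage.Structure M]
  [M ⊨ addLanguage.completeTheory A]

theorem exists_forall_realize_of_completeTheory {α β : Type} [Finite α] [Finite β]
    (ψ : addLanguage.Formula (α ⊕ β))
    (h : ∃ a : α → A, ∀ b : β → A, ψ.Realize (Sum.elim a b)) :
    ∃ a : α → M, ∀ b : β → M, ψ.Realize (Sum.elim a b) := by
  exact (realize_existsForallSentence ψ).1 (Theory.realize_sentence_of_mem
    (addLanguage.completeTheory A) ((realize_existsForallSentence ψ).2 h))

theorem forall_realize_of_completeTheory {β : Type} [Finite β] (ψ : addLanguage.Formula β)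
    (h : ∀ b : β → A, ψ.Realize b) (b : β → M) : ψ.Realize b := by
  obtain ⟨a, ha⟩ := exists_forall_realize_of_completeTheory (A := A) (M := M)
    (α := Empty) (ψ.relabel Sum.inr) ⟨Empty.elim, fun b => by
      simpa only [Formula.realize_relabel, Sum.elim_comp_inr] using h b⟩
  simpa only [Formula.realize_relabel, Sum.elim_comp_inr] using ha b

end Transfer

/-! ### Group structure and subgroup relations in models. -/

section Models

/-- Solving `e + o = e` gives a neutral element, since every `x` has the form `e + y`; inverses come
from solving for it. These axioms need neither 0 nor negation in the language. -/
theorem exists_addCommGroup_of_axioms {M : Type*} [Nonempty M] (f : M → M → M)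
    (assoc : ∀ x y z, f (f x y) z = f x (f y z)) (comm : ∀ x y, f x y = f y x)
    (solve : ∀ x y, ∃ z, f x z = y) : ∃ _ : AddCommGroup M, ∀ x y : M, x + y = f x y := by
  obtain ⟨e⟩ := ‹Nonempty M›
  obtain ⟨o, ho⟩ := solve e e
  have hz : ∀ x, f o x = x := by
    intro x
    obtain ⟨y, rfl⟩ := solve e x
    rw [← assoc, comm o, ho]
  choose n hn using fun x => solve x o
  let _ : Add M := ⟨f⟩
  let _ : Zero M := ⟨o⟩
  let _ : Neg M := ⟨n⟩
  exact ⟨{ AddGroup.ofLeftAxioms (G := M) assoc hz (fun x => (comm _ _).trans (hn x)) with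
    add_comm := comm }, fun _ _ => rfl⟩

theorem structureAdd_eq_add (A : Type*) [AddCommGroup A] (x y : A) : structureAdd x y = x + y := rfl

theorem exists_addCommGroup_of_completeTheory (A : Type*) [AddCommGroup A] (M : Type*)
    [addLanguage.Structure M] [M ⊨ addLanguage.completeTheory A] [Nonempty M] :
    ∃ _ : AddCommGroup M, ∀ x y : M, structureAdd x y = x + y := by
  let v : Fin 3 → addLanguage.Term (Fin 3) := Term.var
  have assoc : ∀ x y z : M, structureAdd (structureAdd x y) z =
      structureAdd x (structureAdd y z) := by
    intro x y z
    have := forall_realize_of_completeTheory (A := A) (M := M)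
      ((addTerm (addTerm (v 0) (v 1)) (v 2)).equal (addTerm (v 0) (addTerm (v 1) (v 2))))
      (fun b => by
        simp only [Formula.realize_equal, realize_addTerm, structureAdd_eq_add A, add_assoc])
      ![x, y, z]
    simpa [Formula.realize_equal, realize_addTerm, v, Term.realize_var] using this
  have comm : ∀ x y : M, structureAdd x y = structureAdd y x := by
    intro x y
    have := forall_realize_of_completeTheory (A := A) (M := M)
      ((addTerm (v 0) (v 1)).equal (addTerm (v 1) (v 0)))
      (fun b => by
        simp only [Formula.realize_equal, realize_addTerm, structureAdd_eq_add A, add_comm])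
      ![x, y, x]
    simpa [Formula.realize_equal, realize_addTerm, v, Term.realize_var] using this
  have solve : ∀ x y : M, ∃ z, structureAdd x z = y := by
    intro x y
    have := forall_realize_of_completeTheory (A := A) (M := M)
      (Formula.iExs (Fin 1) ((addTerm (Term.var (Sum.inl 0)) (Term.var (Sum.inr 0))).equal
        (Term.var (Sum.inl 1) : addLanguage.Term (Fin 2 ⊕ Fin 1))))
      (fun b => by
        simp only [Formula.realize_iExs, Formula.realize_equal, realize_addTerm,
          structureAdd_eq_add A, Term.realize_var, Sum.elim_inl, Sum.elim_inr]
        exact ⟨fun _ => b 1 - b 0, add_sub_cancel _ _⟩)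
      ![x, y]
    simp only [Formula.realize_iExs, Formula.realize_equal, realize_addTerm, Term.realize_var,
      Sum.elim_inl, Sum.elim_inr] at this
    obtain ⟨z, hz⟩ := this
    exact ⟨z 0, hz⟩
  obtain ⟨inst, h⟩ := exists_addCommGroup_of_axioms structureAdd assoc comm solve
  exact ⟨inst, fun x y => (h x y).symm⟩

variable {A : Type*} [AddCommGroup A] {M : Type*} [addLanguage.Structure M]
  [M ⊨ addLanguage.completeTheory A] [AddCommGroup M]

theorem phiSubgroup_le_of_completeTheory (hadd : ∀ x y : M, structureAdd x y = x + y)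
    {q r : ℕ × ℕ} (h : phiSubgroup A q.1 q.2 ≤ phiSubgroup A r.1 r.2) :
    phiSubgroup M q.1 q.2 ≤ phiSubgroup M r.1 r.2 := by
  intro x hx
  let v : Fin 2 → addLanguage.Term (Fin 2) := Term.var
  have := forall_realize_of_completeTheory (A := A) (M := M)
    ((phiFormula q.1 q.2 (v 0) (v 1)).imp (phiFormula r.1 r.2 (v 0) (v 1)))
    (fun b => by
      simp only [Formula.realize_imp, realize_phiFormula (structureAdd_eq_add A)]
      exact fun hb => h hb) ![x, 0]
  simp only [Formula.realize_imp, realize_phiFormula hadd, v, Term.realize_var] at this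
  simpa using this (by simpa using hx)

theorem finite_cover_of_completeTheory (hadd : ∀ x y : M, structureAdd x y = x + y)
    {q r : ℕ × ℕ} {n : ℕ} (h : ∃ a : Fin n → A, ∀ x ∈ phiSubgroup A r.1 r.2,
      ∃ i, x - a i ∈ phiSubgroup A q.1 q.2) :
    ∃ a : Fin n → M, ∀ x ∈ phiSubgroup M r.1 r.2, ∃ i, x - a i ∈ phiSubgroup M q.1 q.2 := by
  -- Without a symbol for 0, membership is stated relative to a second variable `v 1`, finally set
  -- to 0. Fixing `n` keeps the covering property first-order.
  let v : Fin 2 → addLanguage.Term (Fin n ⊕ Fin 2) := fun j => Term.var (Sum.inr j)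
  let u : Fin n → addLanguage.Term (Fin n ⊕ Fin 2) := fun j => Term.var (Sum.inl j)
  have := exists_forall_realize_of_completeTheory (A := A) (M := M)
    ((phiFormula r.1 r.2 (v 0) (v 1)).imp
      (Formula.iSup fun i : Fin n => phiFormula q.1 q.2 (v 0) (addTerm (v 1) (u i))))
    (by
      obtain ⟨a, ha⟩ := h
      refine ⟨a, fun b => ?_⟩
      simp only [Formula.realize_imp, Formula.realize_iSup,
        realize_phiFormula (structureAdd_eq_add A), realize_addTerm, structureAdd_eq_add A, v, u,
        Term.realize_var, Sum.elim_inl, Sum.elim_inr, ← sub_sub]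
      exact fun hb => ha _ hb)
  obtain ⟨a, ha⟩ := this
  refine ⟨a, fun x hx => ?_⟩
  have := ha ![x, 0]
  simp only [Formula.realize_imp, Formula.realize_iSup, realize_phiFormula hadd, realize_addTerm,
    hadd, v, u, Term.realize_var, Sum.elim_inl, Sum.elim_inr] at this
  simpa using this (by simpa using hx)

end Models

/-! ### The criterion: a chain up to finite index. -/

section Chains

variable {M : Type*} [AddCommGroup M]

theorem isDirectedFamily_cosetsOf {P : Set (AddSubgroup M)}
    (hP : ∀ G ∈ P, ∀ H ∈ P, G ≤ H ∨ H ≤ G) : IsDirectedFamily (cosetsOf P) := by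
  have key : ∀ (G H : AddSubgroup M) (a b : M), G ≤ H → ∀ z, z - a ∈ G → z - b ∈ H →
      {x | x - a ∈ G} ⊆ {x | x - b ∈ H} := by
    intro G H a b hGH z hza hzb x hx
    have : x - b = (x - a) - (z - a) + (z - b) := by abel
    change x - b ∈ H
    rw [this]
    exact add_mem (sub_mem (hGH hx) (hGH hza)) hzb
  rintro _ ⟨G, hG, a, rfl⟩ _ ⟨H, hH, b, rfl⟩
  by_cases hz : ∃ z, z - a ∈ G ∧ z - b ∈ H
  · obtain ⟨z, hza, hzb⟩ := hz
    rcases hP G hG H hH with h | h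
    · exact Or.inl (key G H a b h z hza hzb)
    · exact Or.inr (Or.inl (key H G b a h z hzb hza))
  · exact Or.inr (Or.inr (Set.eq_empty_of_forall_notMem fun z hz' => hz ⟨z, hz'⟩))

theorem closure_cosetsOf_le {P Q : Set (AddSubgroup M)}
    (h : ∀ G ∈ P, ∃ H ∈ Q, H ≤ G ∧ ∃ (n : ℕ) (a : Fin n → M), ∀ x ∈ G, ∃ i, x - a i ∈ H) :
    BooleanSubalgebra.closure (cosetsOf P) ≤ BooleanSubalgebra.closure (cosetsOf Q) := by
  refine BooleanSubalgebra.closure_le.2 ?_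
  rintro _ ⟨G, hG, b, rfl⟩
  obtain ⟨H, hH, hHG, n, a, ha⟩ := h G hG
  -- As `H ≤ G`, a translate `a i + H` meeting `G` has `a i ∈ G`, so the others are discarded.
  have : {x | x - b ∈ G} = ⨆ i ∈ {i | a i ∈ G}, {x | x - (b + a i) ∈ H} := by
    ext x
    simp only [Set.iSup_eq_iUnion, Set.mem_iUnion, Set.mem_ofPred_eq, ← sub_sub]
    constructor
    · intro hx
      obtain ⟨i, hi⟩ := ha _ hx
      exact ⟨i, by simpa using sub_mem hx (hHG hi), hi⟩
    · rintro ⟨i, hi, hx⟩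
      simpa using add_mem (hHG hx) hi
  rw [this]
  exact BooleanSubalgebra.biSup_mem (Set.toFinite _) fun i _ =>
    BooleanSubalgebra.subset_closure ⟨H, hH, _, rfl⟩

theorem definable₁_coset_phiSubgroup (q : ℕ × ℕ) (a : M) :
    (Set.univ : Set M).Definable₁ addLanguage {x | x - a ∈ phiSubgroup M q.1 q.2} := by
  let θ : addLanguage.Formula (Fin 2) := phiFormula q.1 q.2 (Term.var 0) (Term.var 1)
  let c : addLanguage[[(Set.univ : Set M)]].Term (Fin 1) :=
    (addLanguage.con (⟨a, trivial⟩ : (Set.univ : Set M))).term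
  refine ⟨BoundedFormula.subst
    ((addLanguage.lhomWithConstants (Set.univ : Set M)).onFormula θ) ![Term.var 0, c], ?_⟩
  ext x
  have key : (BoundedFormula.subst ((addLanguage.lhomWithConstants (Set.univ : Set M)).onFormula θ)
      ![Term.var 0, c]).Realize x default ↔ x 0 - a ∈ phiSubgroup M q.1 q.2 := by
    rw [BoundedFormula.realize_subst]
    change Formula.Realize ((addLanguage.lhomWithConstants (Set.univ : Set M)).onFormula θ) _ ↔ _
    rw [LHom.realize_onFormula, realize_phiFormula (structureAdd_eq_add M)]
    simp only [Term.realize_var, Matrix.cons_val_zero, Matrix.cons_val_one, c, Term.realize_con]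
  exact key.symm

theorem definable₁_of_mem_closure {C : Set (Set M)}
    (hC : ∀ S ∈ C, (Set.univ : Set M).Definable₁ addLanguage S) {S : Set M}
    (hS : S ∈ BooleanSubalgebra.closure C) : (Set.univ : Set M).Definable₁ addLanguage S := by
  induction hS using BooleanSubalgebra.closure_bot_sup_induction with
  | mem S hS => exact hC S hS
  | bot => exact Set.definable_empty
  | sup S _ R _ ihS ihR => exact Set.Definable.union ihS ihR
  | compl S _ ih => exact Set.Definable.compl ih

/-- If the subgroups `phiSubgroup A q.1 q.2` for `q ∈ K` form a chain and each subgroup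
`phiSubgroup A k m` contains one of them with finite index, then the theory of `A` is VC-minimal
and the definable subsets of `A` are the boolean combinations of cosets of the chain. -/
theorem isVCMinimal_and_hasGeneratingPPChain (A : Type*) [AddCommGroup A] (K : Set (ℕ × ℕ))
    (hchain : ∀ q ∈ K, ∀ r ∈ K, phiSubgroup A q.1 q.2 ≤ phiSubgroup A r.1 r.2 ∨
      phiSubgroup A r.1 r.2 ≤ phiSubgroup A q.1 q.2)
    (hfin : ∀ r : ℕ × ℕ, ∃ q ∈ K, phiSubgroup A q.1 q.2 ≤ phiSubgroup A r.1 r.2 ∧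
      ∃ (n : ℕ) (a : Fin n → A), ∀ x ∈ phiSubgroup A r.1 r.2,
        ∃ i, x - a i ∈ phiSubgroup A q.1 q.2) :
    IsVCMinimal.{0, 0, w} (addLanguage.completeTheory A) ∧ HasGeneratingPPChain A := by
  constructor
  · let ψ : ℕ × ℕ → PartitionedFormula addLanguage := fun q =>
      ⟨1, phiFormula q.1 q.2 (Term.var (Sum.inl ())) (Term.var (Sum.inr 0))⟩
    have inst : ∀ (M : Type w) [addLanguage.Structure M] [AddCommGroup M],
        (∀ x y : M, structureAdd x y = x + y) →
        instancesIn (ψ '' K) M = cosetsOf ((fun q => phiSubgroup M q.1 q.2) '' K) := by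
      intro M _ _ hadd
      have hset : ∀ q (a : Fin 1 → M), definedSet (ψ q) a =
          {x | x - a 0 ∈ phiSubgroup M q.1 q.2} := by
        intro q a
        ext x
        exact realize_phiFormula hadd _ _ _ _ _
      ext S
      constructor
      · rintro ⟨_, ⟨q, hq, rfl⟩, a, rfl⟩
        exact ⟨_, ⟨q, hq, rfl⟩, a 0, hset q a⟩
      · rintro ⟨_, ⟨q, hq, rfl⟩, a, rfl⟩
        exact ⟨ψ q, ⟨q, hq, rfl⟩, fun _ => a, (hset q fun _ => a).symm⟩
    refine ⟨ψ '' K, fun M => ?_, fun M S hS => ?_⟩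
    · obtain ⟨_, hadd⟩ := exists_addCommGroup_of_completeTheory A M
      rw [inst M hadd]
      refine isDirectedFamily_cosetsOf ?_
      rintro _ ⟨q, hq, rfl⟩ _ ⟨r, hr, rfl⟩
      exact (hchain q hq r hr).imp (phiSubgroup_le_of_completeTheory hadd)
        (phiSubgroup_le_of_completeTheory hadd)
    · obtain ⟨_, hadd⟩ := exists_addCommGroup_of_completeTheory A M
      rw [inst M hadd]
      refine closure_cosetsOf_le ?_
        (mem_closure_of_definable₁ (fun v => (funMap_add v).trans (hadd _ _)) hS)
      rintro _ ⟨r, rfl⟩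
      obtain ⟨q, hq, hqr, n, ha⟩ := hfin r
      exact ⟨_, ⟨q, hq, rfl⟩, phiSubgroup_le_of_completeTheory hadd hqr, n,
        finite_cover_of_completeTheory hadd ha⟩
  · refine ⟨(fun q => phiSubgroup A q.1 q.2) '' K, ?_, ?_, fun S => ⟨fun hS => ?_, fun hS => ?_⟩⟩
    · rintro _ ⟨q, _, rfl⟩
      exact ⟨{q}, by simp⟩
    · rintro _ ⟨q, hq, rfl⟩ _ ⟨r, hr, rfl⟩ _
      exact hchain q hq r hr
    · refine closure_cosetsOf_le ?_ (mem_closure_of_definable₁ funMap_add hS)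
      rintro _ ⟨r, rfl⟩
      obtain ⟨q, hq, h⟩ := hfin r
      exact ⟨_, ⟨q, hq, rfl⟩, h⟩
    · refine definable₁_of_mem_closure ?_ hS
      rintro _ ⟨_, ⟨q, _, rfl⟩, a, rfl⟩
      exact definable₁_coset_phiSubgroup q a

end Chains

/-! ### Groups in which only one prime matters. -/

section Groups

/-- Multiplication by every natural number prime to `p` is bijective. -/
def PrimeToBijective (p : ℕ) (A : Type*) [AddCommGroup A] : Prop :=
  ∀ n : ℕ, ¬ p ∣ n → Function.Bijective fun x : A => n • x

/-- Every element killed by `p ^ j` is divisible by `p ^ i`. -/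
def TorsionDivisible (p i j : ℕ) (A : Type*) [AddCommGroup A] : Prop :=
  ∀ x : A, p ^ j • x = 0 → ∃ y : A, p ^ i • y = x

variable {p : ℕ} {A B : Type*} [AddCommGroup A] [AddCommGroup B]

theorem PrimeToBijective.prod (hA : PrimeToBijective p A) (hB : PrimeToBijective p B) :
    PrimeToBijective p (A × B) := fun n hn =>
  Function.Bijective.prodMap (hA n hn) (hB n hn)

theorem TorsionDivisible.prod {i j : ℕ} (hA : TorsionDivisible p i j A)
    (hB : TorsionDivisible p i j B) : TorsionDivisible p i j (A × B) := by
  rintro ⟨a, b⟩ h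
  obtain ⟨c, hc⟩ := hA a (congrArg Prod.fst h)
  obtain ⟨d, hd⟩ := hB b (congrArg Prod.snd h)
  exact ⟨(c, d), Prod.ext hc hd⟩

theorem exists_finsupp_nsmul_eq {ι : Type*} (n : ℕ) (x : ι →₀ A)
    (h : ∀ i, ∃ y : A, n • y = x i) : ∃ y : ι →₀ A, n • y = x := by
  classical
  choose y hy using h
  -- Choosing 0 wherever `x` vanishes keeps the support finite.
  refine ⟨Finsupp.onFinset x.support (fun i => if x i = 0 then 0 else y i) fun i hi => ?_, ?_⟩
  · rw [Finsupp.mem_support_iff]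
    intro h
    simp [h] at hi
  · ext i
    rw [Finsupp.smul_apply, Finsupp.onFinset_apply]
    split_ifs with h
    · rw [h, smul_zero]
    · exact hy i

theorem PrimeToBijective.finsupp (ι : Type*) (hA : PrimeToBijective p A) :
    PrimeToBijective p (ι →₀ A) := fun n hn =>
  ⟨fun _ _ h => Finsupp.ext fun i => (hA n hn).1 (DFunLike.congr_fun h i),
    fun x => exists_finsupp_nsmul_eq n x fun i => (hA n hn).2 (x i)⟩

theorem TorsionDivisible.finsupp (ι : Type*) {i j : ℕ} (hA : TorsionDivisible p i j A) :
    TorsionDivisible p i j (ι →₀ A) := fun x hx =>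
  exists_finsupp_nsmul_eq _ x fun k => hA (x k) (DFunLike.congr_fun hx k)

/-- Bézout for `n` and the power of `p` killing `x` inverts `n` on `x`. -/
theorem primeToBijective_of_torsion (hp : p.Prime) (h : ∀ x : A, ∃ n : ℕ, p ^ n • x = 0) :
    PrimeToBijective p A := by
  intro n hn
  have bezout : ∀ x : A, ∃ c : ℤ, n • (c • x) = x := by
    intro x
    obtain ⟨e, he⟩ := h x
    have hcop : IsCoprime (n : ℤ) ((p ^ e : ℕ) : ℤ) :=
      Nat.isCoprime_iff_coprime.2 (((Nat.Prime.coprime_iff_not_dvd hp).2 hn).symm.pow_right e)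
    obtain ⟨c, d, hcd⟩ := hcop
    refine ⟨c, ?_⟩
    have : (c * n + d * (p ^ e : ℕ)) • x = x := by rw [hcd, one_smul]
    rw [add_smul, mul_smul d, natCast_zsmul, he, smul_zero, add_zero, mul_comm, mul_smul,
      natCast_zsmul] at this
    exact this
  constructor
  · intro x y hxy
    obtain ⟨c, hc⟩ := bezout (x - y)
    rw [← sub_eq_zero, ← hc, smul_comm, smul_sub]
    have hxy : n • x = n • y := hxy
    rw [hxy, sub_self, smul_zero]
  · exact fun x => ⟨(bezout x).choose • x, (bezout x).choose_spec⟩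

/-- Prime-to-`p` factors cancel, leaving `p ^ i • y = p ^ j • x`. This always has a solution `y` if
`i ≤ j`; otherwise it says that `x` lies in p^(i-j) A + A[p^j], and `hdich` makes one summand
contain the other. -/
theorem phiSubgroup_eq_pow (hp : p.Prime) (hA : PrimeToBijective p A)
    (hdich : ∀ i j, TorsionDivisible p i j A ∨ ∀ x : A, p ^ (i + j) • x = 0) (k m : ℕ) :
    (∃ i, phiSubgroup A k m = phiSubgroup A (p ^ i) 1) ∨
      ∃ j, phiSubgroup A k m = phiSubgroup A 0 (p ^ j) := by
  have mem : ∀ k m (x : A), x ∈ phiSubgroup A k m ↔ ∃ y : A, k • y = m • x :=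
    fun _ _ _ => Iff.rfl
  have top : (∀ x : A, ∃ y : A, k • y = m • x) →
      ∃ i, phiSubgroup A k m = phiSubgroup A (p ^ i) 1 := fun h =>
    ⟨0, AddSubgroup.ext fun x => by
      rw [mem, mem]
      exact ⟨fun _ => ⟨x, by simp⟩, fun _ => h x⟩⟩
  rcases Nat.eq_zero_or_pos m with rfl | hm
  · exact Or.inl (top fun x => ⟨0, by simp⟩)
  obtain ⟨j, v, hv, rfl⟩ := Nat.exists_eq_pow_mul_and_not_dvd hm.ne' p hp.ne_one
  have hv0 : ∀ x : A, v • x = 0 ↔ x = 0 := fun x =>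
    ⟨fun h => (hA v hv).1 (h.trans (smul_zero v).symm), fun h => by rw [h, smul_zero]⟩
  rcases Nat.eq_zero_or_pos k with rfl | hk
  · refine Or.inr ⟨j, AddSubgroup.ext fun x => ?_⟩
    rw [mem, mem]
    simp only [zero_smul, exists_const]
    rw [mul_comm, mul_smul, eq_comm, hv0, eq_comm]
  obtain ⟨i, u, hu, rfl⟩ := Nat.exists_eq_pow_mul_and_not_dvd hk.ne' p hp.ne_one
  have red : ∀ x : A, (∃ y : A, (p ^ i * u) • y = (p ^ j * v) • x) ↔
      ∃ y : A, p ^ i • y = p ^ j • x := by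
    intro x
    constructor
    · rintro ⟨y, hy⟩
      obtain ⟨z, hz⟩ := (hA v hv).2 (u • y)
      have hz : v • z = u • y := hz
      refine ⟨z, (hA v hv).1 ?_⟩
      change v • p ^ i • z = v • p ^ j • x
      rw [smul_comm, hz, ← mul_smul, hy, mul_comm, mul_smul]
    · rintro ⟨y, hy⟩
      obtain ⟨z, hz⟩ := (hA u hu).2 (v • y)
      have hz : u • z = v • y := hz
      refine ⟨z, ?_⟩
      rw [mul_smul, hz, smul_comm, hy, mul_comm, mul_smul]
  rcases le_or_gt i j with hij | hij
  · refine Or.inl (top fun x => (red x).2 ⟨p ^ (j - i) • x, ?_⟩)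
    rw [← mul_smul, ← pow_add, Nat.add_sub_cancel' hij]
  · have hji : p ^ i = p ^ j * p ^ (i - j) := by rw [← pow_add, Nat.add_sub_cancel' hij.le]
    rcases hdich (i - j) j with h | h
    · refine Or.inl ⟨i - j, AddSubgroup.ext fun x => ?_⟩
      rw [mem, mem, red]
      simp only [one_smul]
      constructor
      · rintro ⟨y, hy⟩
        obtain ⟨z, hz⟩ := h (x - p ^ (i - j) • y) (by
          rw [smul_sub, ← mul_smul, ← hji, hy, sub_self])
        exact ⟨y + z, by rw [smul_add, hz]; abel⟩
      · rintro ⟨y, hy⟩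
        exact ⟨y, by rw [hji, mul_smul, hy]⟩
    · refine Or.inr ⟨j, AddSubgroup.ext fun x => ?_⟩
      rw [mem, mem, red]
      simp only [zero_smul, exists_const]
      rw [Nat.sub_add_cancel hij.le] at h
      simp only [h, exists_const]

/-- Here all the groups `phiSubgroup A k m` already form a chain, so the finite covers are trivial.
-/
theorem isVCMinimal_and_hasGeneratingPPChain_of_prime (hp : p.Prime) (hA : PrimeToBijective p A)
    (hdich : ∀ i j, TorsionDivisible p i j A ∨ ∀ x : A, p ^ (i + j) • x = 0) :
    IsVCMinimal.{0, 0, w} (addLanguage.completeTheory A) ∧ HasGeneratingPPChain A := by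
  refine isVCMinimal_and_hasGeneratingPPChain A Set.univ ?_
    fun r => ⟨r, trivial, le_rfl, 1, 0, fun x hx => ⟨0, by simpa using hx⟩⟩
  have hdiv : ∀ i j, i ≤ j → phiSubgroup A (p ^ j) 1 ≤ phiSubgroup A (p ^ i) 1 := by
    rintro i j hij x ⟨y, hy⟩
    refine ⟨p ^ (j - i) • y, ?_⟩
    rw [← mul_smul, ← pow_add, Nat.add_sub_cancel' hij, hy]
  have htor : ∀ i j, i ≤ j → phiSubgroup A 0 (p ^ i) ≤ phiSubgroup A 0 (p ^ j) := by
    rintro i j hij x ⟨y, hy⟩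
    refine ⟨y, ?_⟩
    rw [zero_smul] at hy ⊢
    rw [← Nat.add_sub_cancel' hij, pow_add, mul_comm, mul_smul, ← hy, smul_zero]
  have hmix : ∀ i j, phiSubgroup A (p ^ i) 1 ≤ phiSubgroup A 0 (p ^ j) ∨
      phiSubgroup A 0 (p ^ j) ≤ phiSubgroup A (p ^ i) 1 := by
    intro i j
    rcases hdich i j with h | h
    · right
      rintro x ⟨y, hy⟩
      rw [zero_smul] at hy
      obtain ⟨z, hz⟩ := h x hy.symm
      exact ⟨z, by rw [hz, one_smul]⟩
    · left
      rintro x ⟨y, hy⟩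
      refine ⟨0, ?_⟩
      rw [one_smul] at hy
      rw [← hy, smul_zero, ← mul_smul, ← pow_add, add_comm, h]
  rintro ⟨k, m⟩ - ⟨l, n⟩ -
  rcases phiSubgroup_eq_pow hp hA hdich k m with ⟨i, hi⟩ | ⟨i, hi⟩ <;>
    rcases phiSubgroup_eq_pow hp hA hdich l n with ⟨j, hj⟩ | ⟨j, hj⟩ <;>
    simp only [hi, hj]
  · exact (le_total j i).imp (hdiv j i) (hdiv i j)
  · exact hmix i j
  · exact (hmix j i).symm
  · exact (le_total i j).imp (htor i j) (htor j i)

/-! ### The concrete groups. -/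

theorem zmod_pow_smul_eq_zero {i n : ℕ} (h : n ≤ i) (x : ZMod (p ^ n)) : p ^ i • x = 0 := by
  rw [nsmul_eq_mul, ← Nat.add_sub_cancel' h, pow_add, Nat.cast_mul, ZMod.natCast_self, zero_mul,
    zero_mul]

theorem primeToBijective_zmod (hp : p.Prime) (n : ℕ) : PrimeToBijective p (ZMod (p ^ n)) :=
  primeToBijective_of_torsion hp fun x => ⟨n, zmod_pow_smul_eq_zero le_rfl x⟩

theorem torsionDivisible_zmod (hp : p.Prime) {i j n : ℕ} (h : i + j ≤ n) :
    TorsionDivisible p i j (ZMod (p ^ n)) := by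
  intro x hx
  have : NeZero (p ^ n) := ⟨pow_ne_zero _ hp.ne_zero⟩
  have hn : p ^ n = p ^ j * p ^ (n - j) := by rw [← pow_add, Nat.add_sub_cancel' (by omega)]
  rw [nsmul_eq_mul, ← ZMod.natCast_zmod_val x, ← Nat.cast_mul, ZMod.natCast_eq_zero_iff] at hx
  -- Being killed by p^j in ℤ/p^n forces divisibility by p^(n-j), and `i ≤ n - j`.
  have hd : p ^ (n - j) ∣ x.val :=
    Nat.dvd_of_mul_dvd_mul_left (pow_pos hp.pos j) (hn.symm.dvd.trans hx)
  replace hd : p ^ i ∣ x.val := (pow_dvd_pow p (by omega)).trans hd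
  obtain ⟨y, hy⟩ := hd
  refine ⟨(y : ZMod (p ^ n)), ?_⟩
  rw [nsmul_eq_mul, ← Nat.cast_mul, ← hy, ZMod.natCast_zmod_val]

theorem prufer_pow_torsion (x : Prufer p) : ∃ n : ℕ, p ^ n • x = 0 := by
  induction x using AddCommGroup.DirectLimit.induction_on with
  | ih i x => exact ⟨i, by rw [← map_nsmul, zmod_pow_smul_eq_zero le_rfl, map_zero]⟩

theorem prufer_divisible (hp : p.Prime) (i : ℕ) (x : Prufer p) : ∃ y, p ^ i • y = x := by
  induction x using AddCommGroup.DirectLimit.induction_on with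
  | ih k x =>
    have : NeZero (p ^ k) := ⟨pow_ne_zero _ hp.ne_zero⟩
    -- The transition map from level `k` to level `k + i` multiplies by p^i, so the same residue
    -- placed at level `k + i` is a p^i-th part of `x`.
    refine ⟨AddCommGroup.DirectLimit.of _ (pruferMap p) (k + i) (x.val : ZMod (p ^ (k + i))), ?_⟩
    rw [← map_nsmul]
    refine Eq.trans (congrArg _ ?_)
      (AddCommGroup.DirectLimit.of_f (f := pruferMap p) (Nat.le_add_right k i) x)
    have hx : x = ((x.val : ℤ) : ZMod (p ^ k)) := by simp
    conv_rhs => rw [hx]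
    rw [pruferMap, ZMod.lift_coe]
    simp [mul_comm]

/-- The localization is torsion-free, so only `x = 0` has to be divided. -/
theorem torsionDivisible_zLocalized [hp : Fact p.Prime] (i j : ℕ) :
    TorsionDivisible p i j (ZLocalized p) := by
  intro x hx
  have hle := (Ideal.span {(p : ℤ)}).primeCompl_le_nonZeroDivisors
  have := IsLocalization.isDomain_localization hle
  have hinj := IsLocalization.injective (ZLocalized p) hle
  have hp0 : ((p ^ j : ℕ) : ZLocalized p) ≠ 0 := by
    intro h
    have : algebraMap ℤ (ZLocalized p) ((p ^ j : ℕ) : ℤ) = algebraMap ℤ (ZLocalized p) 0 := by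
      rw [map_natCast, map_zero, h]
    exact pow_ne_zero j hp.out.ne_zero (by exact_mod_cast hinj this)
  rw [nsmul_eq_mul] at hx
  exact ⟨0, by rw [nsmul_eq_mul, mul_zero, (mul_eq_zero.1 hx).resolve_left hp0]⟩

theorem primeToBijective_zLocalized [hp : Fact p.Prime] : PrimeToBijective p (ZLocalized p) := by
  intro n hn
  have hu : IsUnit (algebraMap ℤ (ZLocalized p) n) :=
    IsLocalization.map_units (ZLocalized p) (⟨(n : ℤ), fun h => hn (by
      rwa [SetLike.mem_coe, Ideal.mem_span_singleton, Int.natCast_dvd_natCast] at h)⟩ :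
        (Ideal.span {(p : ℤ)}).primeCompl)
  have : (fun x : ZLocalized p => n • x) = fun x => algebraMap ℤ (ZLocalized p) n * x := by
    funext x
    simp
  rw [this]
  exact IsUnit.isUnit_iff_mulLeft_bijective.1 hu

theorem int_isVCMinimal_and_hasGeneratingPPChain :
    IsVCMinimal.{0, 0, w} (addLanguage.completeTheory ℤ) ∧ HasGeneratingPPChain ℤ := by
  have mem : ∀ k m (x : ℤ), x ∈ phiSubgroup ℤ k m ↔ (k : ℤ) ∣ m * x := by
    intro k m x
    change (∃ y : ℤ, k • y = m • x) ↔ _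
    simp only [nsmul_eq_mul]
    exact exists_congr fun y => eq_comm
  have mem1 : ∀ k (x : ℤ), x ∈ phiSubgroup ℤ k 1 ↔ (k : ℤ) ∣ x := fun k x => by simp [mem]
  refine isVCMinimal_and_hasGeneratingPPChain ℤ
    (insert (0, 1) (Set.range fun n : ℕ => (n.factorial, 1))) ?_ ?_
  · have hzero : ∀ r : ℕ × ℕ, phiSubgroup ℤ 0 1 ≤ phiSubgroup ℤ r.1 r.2 := by
      intro r x hx
      have : x = 0 := by simpa [mem1] using hx
      exact this ▸ zero_mem _
    rintro q (rfl | ⟨m, rfl⟩) r (rfl | ⟨n, rfl⟩)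
    · exact Or.inl (hzero _)
    · exact Or.inl (hzero _)
    · exact Or.inr (hzero _)
    · have hfac : ∀ m n : ℕ, m ≤ n →
          phiSubgroup ℤ n.factorial 1 ≤ phiSubgroup ℤ m.factorial 1 := by
        intro m n hmn x hx
        rw [mem1] at hx ⊢
        exact (Int.natCast_dvd_natCast.2 (Nat.factorial_dvd_factorial hmn)).trans hx
      exact (le_total n m).imp (hfac n m) (hfac m n)
  · have hself : ∀ q : ℕ × ℕ, ∃ (n : ℕ) (a : Fin n → ℤ), ∀ x ∈ phiSubgroup ℤ q.1 q.2,
        ∃ i, x - a i ∈ phiSubgroup ℤ q.1 q.2 := fun q =>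
      ⟨1, 0, fun x hx => ⟨0, by simpa using hx⟩⟩
    rintro ⟨k, m⟩
    rcases Nat.eq_zero_or_pos k with rfl | hk
    · rcases Nat.eq_zero_or_pos m with rfl | hm
      · refine ⟨_, Or.inr ⟨0, rfl⟩, fun x _ => by simp [mem], 1, 0, fun x _ => ⟨0, by simp [mem]⟩⟩
      · have : phiSubgroup ℤ 0 m = phiSubgroup ℤ 0 1 := by
          ext x
          simp [mem, hm.ne']
        exact ⟨_, Or.inl rfl, this.ge, by simpa only [this] using hself (0, 1)⟩
    -- For `k > 0` the subgroup contains kℤ, hence k!ℤ, whose cosets are represented by 0, …, k! -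
    -- 1.
    · refine ⟨_, Or.inr ⟨k, rfl⟩, fun x hx => ?_, k.factorial, fun i => i, fun x _ => ?_⟩
      · rw [mem1] at hx
        rw [mem]
        exact ((Int.natCast_dvd_natCast.2 (Nat.dvd_factorial hk le_rfl)).trans hx).mul_left _
      · have hpos : (0 : ℤ) < k.factorial := by exact_mod_cast k.factorial_pos
        have hr := Int.emod_nonneg x hpos.ne'
        have hr' := Int.emod_lt_of_pos x hpos
        refine ⟨⟨(x % k.factorial).toNat, by omega⟩, ?_⟩
        rw [mem1]
        simp only [Int.toNat_of_nonneg hr]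
        exact Int.dvd_self_sub_emod

end Groups

end VCMinimality

theorem corollary5 :
    (VCMinimality.IsVCMinimal.{0, 0, w} (VCMinimality.addLanguage.completeTheory ℤ) ∧
      VCMinimality.HasGeneratingPPChain ℤ) ∧
    (∀ p k : ℕ, p.Prime →
      VCMinimality.IsVCMinimal.{0, 0, w}
        (VCMinimality.addLanguage.completeTheory (ℕ →₀ ZMod (p ^ k))) ∧
      VCMinimality.HasGeneratingPPChain (ℕ →₀ ZMod (p ^ k))) ∧
    (∀ p k : ℕ, p.Prime →
      VCMinimality.IsVCMinimal.{0, 0, w}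
        (VCMinimality.addLanguage.completeTheory
          ((ℕ →₀ ZMod (p ^ k)) × (ℕ →₀ ZMod (p ^ (k + 1))))) ∧
      VCMinimality.HasGeneratingPPChain
        ((ℕ →₀ ZMod (p ^ k)) × (ℕ →₀ ZMod (p ^ (k + 1))))) ∧
    (∀ (p : ℕ) [Fact p.Prime] (β : Type u) (γ : Type v),
      VCMinimality.IsVCMinimal.{0, 0, w}
        (VCMinimality.addLanguage.completeTheory
          ((β →₀ VCMinimality.Prufer p) × (γ →₀ VCMinimality.ZLocalized p))) ∧
      VCMinimality.HasGeneratingPPChain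
        ((β →₀ VCMinimality.Prufer p) × (γ →₀ VCMinimality.ZLocalized p))) := by

  refine ⟨VCMinimality.int_isVCMinimal_and_hasGeneratingPPChain, fun p k hp => ?_,
    fun p k hp => ?_, fun p hp β γ => ?_⟩
  · refine VCMinimality.isVCMinimal_and_hasGeneratingPPChain_of_prime hp
      ((VCMinimality.primeToBijective_zmod hp k).finsupp ℕ) fun i j => ?_
    rcases le_total (i + j) k with h | h
    · exact Or.inl ((VCMinimality.torsionDivisible_zmod hp h).finsupp ℕ)
    · exact Or.inr fun x => Finsupp.ext fun n => VCMinimality.zmod_pow_smul_eq_zero h (x n)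
  · refine VCMinimality.isVCMinimal_and_hasGeneratingPPChain_of_prime hp
      (((VCMinimality.primeToBijective_zmod hp k).finsupp ℕ).prod
        ((VCMinimality.primeToBijective_zmod hp (k + 1)).finsupp ℕ)) fun i j => ?_
    -- Consecutive exponents leave no gap: `i + j ≥ k + 1` kills both summands, and `i + j ≤ k`
    -- gives divisibility in both.
    rcases Nat.lt_or_ge k (i + j) with h | h
    · exact Or.inr fun x => Prod.ext
        (Finsupp.ext fun n => VCMinimality.zmod_pow_smul_eq_zero h.le (x.1 n))
        (Finsupp.ext fun n => VCMinimality.zmod_pow_smul_eq_zero h (x.2 n))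
    · exact Or.inl (((VCMinimality.torsionDivisible_zmod hp h).finsupp ℕ).prod
        ((VCMinimality.torsionDivisible_zmod hp (h.trans k.le_succ)).finsupp ℕ))
  · refine VCMinimality.isVCMinimal_and_hasGeneratingPPChain_of_prime hp.out
      (((VCMinimality.primeToBijective_of_torsion hp.out
        VCMinimality.prufer_pow_torsion).finsupp β).prod
        (VCMinimality.primeToBijective_zLocalized.finsupp γ)) fun i j => Or.inl ?_
    have h1 : VCMinimality.TorsionDivisible p i j (VCMinimality.Prufer p) :=
      fun x _ => VCMinimality.prufer_divisible hp.out i x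
    exact (h1.finsupp β).prod ((VCMinimality.torsionDivisible_zLocalized i j).finsupp γ)
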